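/- Theorem 5.3. Let $R$ be an associative ring with $1$ and let $\mathcal B$ be an additive subcategory of $R\text{-mod}$, i.e. a full, isomorphism-closed subcategory of the category of finitely presented left $R$-modules that contains $0$ and is closed under finite direct sums. Let $\{B_i\}_{i\in I}$ be a set of modules in $\mathcal B$ such that every module in $\mathcal B$ is isomorphic to some $B_i$ (for example, a skeleton of $\mathcal B$) and put $M=\bigoplus_{i\in I}B_i$. For a left $R$-module $N$ let $N^*=\mathrm{Hom}_{\mathbb Z}(N,\mathbb Q/\mathbb Z)$, a right $R$-module; for a class $\mathcal X$ of left modules let $\mathcal X^*$ be the class of modules isomorphic to $N^*$ with $N\in\mathcal X$. For a class $\mathcal X$ of modules let $\mathrm{Prod}(\mathcal X)$ be its closure under direct products and direct summands, $\mathrm{Prod}^+(\mathcal X)$ its closure under direct products and pure submodules, $\mathcal X^+$ its closure under pure submodules, and $\varinjlim\mathcal X$ its closure under direct limits in the category of all modules. A class of modules is a definable subcategory if it is closed under direct products, direct limits and pure submodules; the elementary dual of a definable subcategory $\mathcal D$ of left $R$-modules is the class $(\mathcal D^*)^+$ of right $R$-modules. A module $N$ is $\Sigma$-pure-injective if the direct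 sum $N^{(J)}$ is pure-injective for every infinite set $J$. Then $M^*\cong\prod_{i\in I}B_i^*$, and the following conditions are equivalent: (i) $\mathrm{Prod}(\mathcal B^*)$ is a definable subcategory of the category of right $R$-modules; (ii) $M^*$ is $\Sigma$-pure-injective; (iii) $M$ is noetherian as a module over its endomorphism ring $\mathrm{End}_R(M)$. If they hold, then $\mathrm{Prod}(\mathcal B^*)=\mathrm{Prod}^+(\mathcal B^*)$, this class is definable, $\varinjlim\mathcal B$ is a definable subcategory of the category of left $R$-modules, and $\mathrm{Prod}(\mathcal B^*)$ is the elementary dual of $\varinjlim\mathcal B$. -/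

import Mathlib

open CategoryTheory

universe u

namespace ModClass

section General

/-! Modules over a ring `S`.  Left `R`-modules are objects of `ModuleCat R`, right `R`-modules are
objects of `ModuleCat Rᵐᵒᵖ`.  A class of modules is a predicate on `ModuleCat S`. -/

variable {S : Type u} [Ring S]

/-- A pure embedding: an injective homomorphism `f : A → B` such that every finite system of
`S`-linear equations with constants in `A` which is solvable in `B` (after applying `f` to the
constants) is already solvable in `A`.  A submodule is pure if its inclusion is pure. -/
structure IsPureEmbedding {A B : Type u} [AddCommGroup A] [Module S A] [AddCommGroup B] [Module S B]
    (f : A →ₗ[S] B) : Prop where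
  injective : Function.Injective f
  solvable : ∀ (m n : ℕ) (r : Fin m → Fin n → S) (a : Fin m → A),
    (∃ x : Fin n → B, ∀ i, ∑ j, r i j • x j = f (a i)) →
      ∃ y : Fin n → A, ∀ i, ∑ j, r i j • y j = a i

/-- A module is pure-injective if homomorphisms into it extend along all pure embeddings. -/
def IsPureInjective (N : ModuleCat.{u} S) : Prop :=
  ∀ (A B : ModuleCat.{u} S) (f : A →ₗ[S] B), IsPureEmbedding f →
    ∀ g : A →ₗ[S] N, ∃ h : B →ₗ[S] N, h ∘ₗ f = g

/-- A module `N` is `Σ`-pure-injective if the direct sum `N^(I)` is pure-injective for every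
infinite set `I`. -/
def IsSigmaPureInjective (N : ModuleCat.{u} S) : Prop :=
  ∀ (I : Type u) [Infinite I], IsPureInjective (ModuleCat.of S (I →₀ N))

/-- `Prod(X)`: the closure of the class `X` under direct products and direct summands.  Taking `i`
and `p` mutually inverse in `summand` shows that it is closed under isomorphism. -/
inductive ProdClosure (X : ObjectProperty (ModuleCat.{u} S)) : ObjectProperty (ModuleCat.{u} S)
  | base (N : ModuleCat.{u} S) (h : X N) : ProdClosure X N
  | product {I : Type u} (N : I → ModuleCat.{u} S) (h : ∀ i, ProdClosure X (N i)) :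
      ProdClosure X (ModuleCat.of S (∀ i, N i))
  | summand (N L : ModuleCat.{u} S) (i : L →ₗ[S] N) (p : N →ₗ[S] L) (hpi : p ∘ₗ i = LinearMap.id)
      (h : ProdClosure X N) : ProdClosure X L

/-- `Prod⁺(X)`: the closure of the class `X` under direct products and pure submodules. -/
inductive ProdPlusClosure (X : ObjectProperty (ModuleCat.{u} S)) :
    ObjectProperty (ModuleCat.{u} S)
  | base (N : ModuleCat.{u} S) (h : X N) : ProdPlusClosure X N
  | product {I : Type u} (N : I → ModuleCat.{u} S) (h : ∀ i, ProdPlusClosure X (N i)) :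
      ProdPlusClosure X (ModuleCat.of S (∀ i, N i))
  | pureSubmodule (N L : ModuleCat.{u} S) (i : L →ₗ[S] N) (hi : IsPureEmbedding i)
      (h : ProdPlusClosure X N) : ProdPlusClosure X L

/-- `X⁺`: the closure of the class `X` under pure submodules. -/
inductive PureClosure (X : ObjectProperty (ModuleCat.{u} S)) : ObjectProperty (ModuleCat.{u} S)
  | base (N : ModuleCat.{u} S) (h : X N) : PureClosure X N
  | pureSubmodule (N L : ModuleCat.{u} S) (i : L →ₗ[S] N) (hi : IsPureEmbedding i)
      (h : PureClosure X N) : PureClosure X L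

/-- `lim X`: the closure of the class `X` under direct limits (and isomorphism) in the category of
all modules. -/
inductive LimClosure (X : ObjectProperty (ModuleCat.{u} S)) : ObjectProperty (ModuleCat.{u} S)
  | base (N : ModuleCat.{u} S) (h : X N) : LimClosure X N
  | directLimit {I : Type u} [Preorder I] [IsDirectedOrder I] [Nonempty I] [DecidableEq I]
      (G : I → ModuleCat.{u} S) (f : ∀ i j, i ≤ j → G i →ₗ[S] G j)
      [DirectedSystem (fun i => G i) (fun i j h => f i j h)] (h : ∀ i, LimClosure X (G i)) :
      LimClosure X (ModuleCat.of S (Module.DirectLimit (fun i => G i) f))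
  | iso (N L : ModuleCat.{u} S) (e : N ≃ₗ[S] L) (h : LimClosure X N) : LimClosure X L

/-- A class of modules is a definable subcategory if it is closed under direct products, direct
limits and pure submodules (hence under isomorphism, an isomorphism being a pure embedding). -/
structure IsDefinable (X : ObjectProperty (ModuleCat.{u} S)) : Prop where
  product : ∀ {I : Type u} (N : I → ModuleCat.{u} S), (∀ i, X (N i)) →
    X (ModuleCat.of S (∀ i, N i))
  directLimit : ∀ {I : Type u} [Preorder I] [IsDirectedOrder I] [Nonempty I] [DecidableEq I]
    (G : I → ModuleCat.{u} S) (f : ∀ i j, i ≤ j → G i →ₗ[S] G j)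
    [DirectedSystem (fun i => G i) (fun i j h => f i j h)], (∀ i, X (G i)) →
      X (ModuleCat.of S (Module.DirectLimit (fun i => G i) f))
  pureSubmodule : ∀ (N L : ModuleCat.{u} S) (i : L →ₗ[S] N), IsPureEmbedding i → X N → X L

/-- The class of objects of an additive subcategory of the category of finitely presented modules:
a full subcategory, closed under isomorphism, consisting of finitely presented modules, which
contains the zero module and is closed under finite direct sums. -/
structure IsAdditiveFP (B : ObjectProperty (ModuleCat.{u} S)) : Prop where
  finitePresentation : ∀ N : ModuleCat.{u} S, B N → Module.FinitePresentation S N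
  iso : ∀ N L : ModuleCat.{u} S, (N ≃ₗ[S] L) → B N → B L
  zero : B (ModuleCat.of S PUnit.{u + 1})
  sum : ∀ N L : ModuleCat.{u} S, B N → B L → B (ModuleCat.of S (N × L))

end General

section Duality

variable {R : Type u} [Ring R]

/-- The right `R`-module structure `(f r)(m) = f (r m)` on `Hom_ℤ(M, ℚ/ℤ)`, for a left `R`-module
`M`. -/
instance characterRightModule (M : Type u) [AddCommGroup M] [Module R M] :
    Module Rᵐᵒᵖ (CharacterModule M) where
  smul r f := AddMonoidHom.comp (f : M →+ AddCircle (1 : ℚ))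
    (DistribSMul.toAddMonoidHom M (MulOpposite.unop r))
  one_smul f := CharacterModule.ext M fun x => congrArg f (one_smul R x)
  mul_smul r s f := CharacterModule.ext M fun x =>
    congrArg f (mul_smul (MulOpposite.unop s) (MulOpposite.unop r) x)
  smul_zero _ := rfl
  smul_add _ _ _ := rfl
  add_smul r s f := CharacterModule.ext M fun x =>
    (congrArg f (add_smul (MulOpposite.unop r) (MulOpposite.unop s) x)).trans (map_add f _ _)
  zero_smul f := CharacterModule.ext M fun x => (congrArg f (zero_smul R x)).trans (map_zero f)

theorem op_smul_character_apply (M : Type u) [AddCommGroup M] [Module R M] (r : R)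
    (f : CharacterModule M) (x : M) : (MulOpposite.op r • f) x = f (r • x) := rfl

/-- The dual `M^* = Hom_ℤ(M, ℚ/ℤ)` of a left `R`-module, as a right `R`-module. -/
noncomputable def dual (M : ModuleCat.{u} R) : ModuleCat.{u} Rᵐᵒᵖ :=
  ModuleCat.of Rᵐᵒᵖ (CharacterModule M)

/-- `X^*`: the class of all modules isomorphic to the dual of a module in `X`. -/
def dualClass (X : ObjectProperty (ModuleCat.{u} R)) : ObjectProperty (ModuleCat.{u} Rᵐᵒᵖ) :=
  fun N => ∃ M : ModuleCat.{u} R, X M ∧ Nonempty (N ≃ₗ[Rᵐᵒᵖ] dual M)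

/-- The elementary dual `D^d = (D^*)⁺` of a definable subcategory `D` of left `R`-modules. -/
def elementaryDual (D : ObjectProperty (ModuleCat.{u} R)) : ObjectProperty (ModuleCat.{u} Rᵐᵒᵖ) :=
  PureClosure (dualClass D)

end Duality

end ModClass

/-!
Duality turns positive primitive formulas around: over the dual `M^*`, a formula defines the
annihilator of the subgroup which the dual formula defines in `M` (`PPFormula.dualSol`). This is the
injectivity of `ℚ/ℤ` (`exists_character_solution_iff`), and it shows that inclusions between
definable subgroups of `M^*` correspond to reverse inclusions in `M`
(`PPFormula.sol_character_le_iff`). It also shows that `M^*` is algebraically compact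
(`isAlgebraicallyCompact_character`), hence pure-injective. The subgroups of `M` so obtained are
submodules over `End M`, and if `M` is the direct sum of representatives of `B`, every finitely
generated submodule over `End M` is one of them (`IsAdditiveFP.exists_dualSubmodule_eq`). So `M` is
noetherian over `End M` if and only if `M^*` has the descending chain condition on subgroups
defined by formulas.

A `Σ`-pure-injective module has this chain condition, by an argument with a retraction
`N^ℕ → N^(ℕ)` (`IsSigmaPureInjective.exists_sol_le`). Conversely, the chain condition gives algebraic
compactness and passes from `M^*` to products and pure submodules, so all modules in
`Prod⁺(B^*)` are then pure-injective and all pure embeddings between them split. Hence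
`Prod(B^*) = Prod⁺(B^*)`, and this class is closed under direct limits, because a direct limit is the
quotient of a direct sum by a pure submodule (`isDefinable_prodPlusClosure`). If `Prod(B^*)` is
definable, it contains `(M^*)^(J)`, and its members are always pure-injective, which closes the
circle.

A module lies in `lim B` if and only if homomorphisms into it from finitely presented modules factor
through modules in `B` (`LimClosure.factorsThrough`, `FactorsThrough.limClosure`). This criterion is
inherited by pure submodules. It is inherited by products if finitely presented modules have left
`B`-approximations, which exist when `M` is noetherian over `End M`
(`IsAdditiveFP.exists_leftApproximation`). Finally `Prod(B^*)` is the elementary dual of `lim B`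
because the dual of a direct limit is pure in the product of the duals, and a product of duals is
the dual of a direct sum.
-/

namespace ModClass

section Purity

/-! ### Pure embeddings -/

variable {S : Type u} [Ring S] {A B C : Type u} [AddCommGroup A] [Module S A] [AddCommGroup B]
  [Module S B] [AddCommGroup C] [Module S C]

/-- Pure embeddings reflect solvability of systems indexed by arbitrary finite types. -/
theorem IsPureEmbedding.exists_solution {f : A →ₗ[S] B} (hf : IsPureEmbedding f) {ι κ : Type*}
    [Fintype ι] [Fintype κ] (r : ι → κ → S) (a : ι → A)
    (h : ∃ x : κ → B, ∀ i, ∑ j, r i j • x j = f (a i)) :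
    ∃ y : κ → A, ∀ i, ∑ j, r i j • y j = a i := by
  obtain ⟨x, hx⟩ := h
  let e := Fintype.equivFin ι
  let d := Fintype.equivFin κ
  obtain ⟨y, hy⟩ := hf.solvable _ _ (fun i j => r (e.symm i) (d.symm j)) (fun i => a (e.symm i))
    ⟨fun j => x (d.symm j), fun i => by
      rw [← hx, ← Equiv.sum_comp d.symm]⟩
  refine ⟨fun j => y (d j), fun i => ?_⟩
  have := hy (e i)
  rw [← Equiv.sum_comp d] at this
  simpa using this

theorem IsPureEmbedding.of_leftInverse (f : A →ₗ[S] B) (p : B →ₗ[S] A)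
    (h : p ∘ₗ f = LinearMap.id) : IsPureEmbedding f where
  injective := Function.LeftInverse.injective (g := p) fun x => LinearMap.congr_fun h x
  solvable m n r a := by
    rintro ⟨x, hx⟩
    refine ⟨fun j => p (x j), fun i => ?_⟩
    have := congrArg p (hx i)
    rw [← LinearMap.comp_apply p f, h] at this
    simpa using this

theorem IsPureEmbedding.of_equiv (e : A ≃ₗ[S] B) : IsPureEmbedding e.toLinearMap :=
  .of_leftInverse _ e.symm.toLinearMap (by ext; simp)

theorem IsPureEmbedding.comp {g : B →ₗ[S] C} {f : A →ₗ[S] B} (hg : IsPureEmbedding g)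
    (hf : IsPureEmbedding f) : IsPureEmbedding (g ∘ₗ f) where
  injective := hg.injective.comp hf.injective
  solvable m n r a h := hf.solvable m n r a (hg.solvable m n r (fun i => f (a i)) h)

theorem IsPureEmbedding.pi {I : Type u} {A B : I → Type u} [∀ i, AddCommGroup (A i)]
    [∀ i, Module S (A i)] [∀ i, AddCommGroup (B i)] [∀ i, Module S (B i)]
    (f : ∀ i, A i →ₗ[S] B i) (hf : ∀ i, IsPureEmbedding (f i)) :
    IsPureEmbedding (LinearMap.pi fun i => f i ∘ₗ LinearMap.proj i) where
  injective x y h := funext fun i => (hf i).injective (congrFun h i)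
  solvable m n r a := by
    rintro ⟨x, hx⟩
    have (i : I) := (hf i).solvable m n r (fun k => a k i) ⟨fun j => x j i, fun k => by
      simpa using congrFun (hx k) i⟩
    choose y hy using this
    exact ⟨fun j i => y i j, fun k => funext fun i => by simpa using hy i k⟩

/-- The direct sum is pure in the direct product: a solution of a finite system in the product
can be cut off outside the finite support of the constants. -/
theorem isPureEmbedding_directSum_pi {I : Type u} (A : I → Type u)
    [∀ i, AddCommGroup (A i)] [∀ i, Module S (A i)] :
    IsPureEmbedding (DirectSum.coeFnLinearMap S : (DirectSum I A) →ₗ[S] ∀ i, A i) where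
  injective := DFunLike.coe_injective
  solvable m n r a := by
    classical
    rintro ⟨x, hx⟩
    let s : Finset I := Finset.univ.biUnion fun i => DFinsupp.support (a i)
    refine ⟨fun j => DFinsupp.mk s fun i => x j i, fun k => DFinsupp.ext fun i => ?_⟩
    have h : (∑ j, r k j • (show DirectSum I A from DFinsupp.mk s fun i => x j i)) i =
        ∑ j, r k j • (DFinsupp.mk s (fun i => x j i) : Π₀ i, A i) i := by
      rw [DFinsupp.finsetSum_apply]; rfl
    refine h.trans ?_
    by_cases hi : i ∈ s
    · simpa [DFinsupp.mk_apply, hi] using congrFun (hx k) i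
    · have : (a k) i = 0 := by
        by_contra h0
        exact hi (Finset.mem_biUnion.2 ⟨k, Finset.mem_univ _, (DFinsupp.mem_support_iff).2 h0⟩)
      simp [DFinsupp.mk_apply, hi, this]

theorem isPureEmbedding_finsupp_pi (I : Type u) :
    IsPureEmbedding (Finsupp.lcoeFun : (I →₀ A) →ₗ[S] I → A) where
  injective := DFunLike.coe_injective
  solvable m n r a := by
    classical
    rintro ⟨x, hx⟩
    let s : Finset I := Finset.univ.biUnion fun i => (a i).support
    refine ⟨fun j => Finsupp.onFinset s (fun i => if i ∈ s then x j i else 0) fun i hi => by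
      by_contra h; exact hi (if_neg h), fun k => Finsupp.ext fun i => ?_⟩
    rw [Finsupp.finsetSum_apply]
    by_cases hi : i ∈ s
    · simpa [hi] using congrFun (hx k) i
    · have : (a k) i = 0 := by
        by_contra h0
        exact hi (Finset.mem_biUnion.2 ⟨k, Finset.mem_univ _, Finsupp.mem_support_iff.2 h0⟩)
      simp [hi, this]

end Purity

section PureInjective

/-! ### Pure-injective modules -/

variable {S : Type u} [Ring S]

theorem IsPureInjective.of_retract {N L : ModuleCat.{u} S} (hN : IsPureInjective N)
    (i : L →ₗ[S] N) (p : N →ₗ[S] L) (h : p ∘ₗ i = LinearMap.id) : IsPureInjective L := by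
  intro A B f hf g
  obtain ⟨k, hk⟩ := hN A B f hf (i ∘ₗ g)
  exact ⟨p ∘ₗ k, by rw [LinearMap.comp_assoc, hk, ← LinearMap.comp_assoc, h, LinearMap.id_comp]⟩

theorem IsPureInjective.pi {I : Type u} {N : I → ModuleCat.{u} S} (hN : ∀ i, IsPureInjective (N i)) :
    IsPureInjective (ModuleCat.of S (∀ i, N i)) := by
  intro A B f hf g
  choose k hk using fun i => hN i A B f hf (LinearMap.proj i ∘ₗ g)
  exact ⟨LinearMap.pi k, LinearMap.ext fun a => funext fun i => LinearMap.congr_fun (hk i) a⟩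

/-- A pure-injective module is a direct summand of every module in which it is pure. -/
theorem IsPureInjective.exists_retraction {L N : ModuleCat.{u} S} (hL : IsPureInjective L)
    (f : L →ₗ[S] N) (hf : IsPureEmbedding f) : ∃ p : N →ₗ[S] L, p ∘ₗ f = LinearMap.id :=
  hL L N f hf LinearMap.id

end PureInjective

section PPFormula

/-! ### Positive primitive formulas and algebraic compactness -/

/-- A positive primitive formula `∃ y, ∀ i, s i • x + ∑ j, r i j • y j = 0` in one free variable
`x`, over the ring `S`. The finite index types `eqn` of the equations and `var` of the bound
variables are arbitrary, so that conjunctions are indexed by disjoint unions. -/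
structure PPFormula (S : Type u) where
  eqn : Type
  var : Type
  [fintypeEqn : Fintype eqn]
  [fintypeVar : Fintype var]
  coeff : eqn → var → S
  free : eqn → S

attribute [instance] PPFormula.fintypeEqn PPFormula.fintypeVar

/-- A positive primitive formula with parameters in `N`: the constants on the right hand sides
of the equations are `const`. -/
structure PPSystem (S : Type u) (N : Type u) extends PPFormula S where
  const : eqn → N

variable {S : Type u} [Ring S] {N L : Type u} [AddCommGroup N] [Module S N] [AddCommGroup L]
  [Module S L]

/-- The subgroup of `N` defined by a positive primitive formula. -/
def PPFormula.sol (φ : PPFormula S) (N : Type u) [AddCommGroup N] [Module S N] : AddSubgroup N where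
  carrier := {x | ∃ y : φ.var → N, ∀ i, φ.free i • x + ∑ j, φ.coeff i j • y j = 0}
  zero_mem' := ⟨0, by simp⟩
  add_mem' := by
    rintro a b ⟨y, hy⟩ ⟨z, hz⟩
    refine ⟨y + z, fun i => ?_⟩
    simp only [Pi.add_apply, smul_add, Finset.sum_add_distrib]
    rw [add_add_add_comm, hy, hz, add_zero]
  neg_mem' := by
    rintro a ⟨y, hy⟩
    refine ⟨-y, fun i => ?_⟩
    simp only [Pi.neg_apply, smul_neg, Finset.sum_neg_distrib]
    rw [← neg_add, hy, neg_zero]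

/-- The set of solutions of a positive primitive formula with parameters. -/
def PPSystem.sol (p : PPSystem S N) : Set N :=
  {x | ∃ y : p.var → N, ∀ i, p.free i • x + ∑ j, p.coeff i j • y j = p.const i}

/-- The conjunction of two positive primitive formulas. -/
def PPFormula.conj (φ ψ : PPFormula S) : PPFormula S where
  eqn := φ.eqn ⊕ ψ.eqn
  var := φ.var ⊕ ψ.var
  coeff := Sum.elim (fun i => Sum.elim (φ.coeff i) fun _ => 0)
    (fun i => Sum.elim (fun _ => 0) (ψ.coeff i))
  free := Sum.elim φ.free ψ.free

/-- The conjunction of two positive primitive formulas with parameters. -/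
def PPSystem.conj (p q : PPSystem S N) : PPSystem S N where
  toPPFormula := p.toPPFormula.conj q.toPPFormula
  const := Sum.elim p.const q.const

theorem PPSystem.mem_sol_conj {p q : PPSystem S N} {x : N} :
    x ∈ (p.conj q).sol ↔ x ∈ p.sol ∧ x ∈ q.sol := by
  constructor
  · rintro ⟨y, hy⟩
    refine ⟨⟨fun j => y (Sum.inl j), fun i => ?_⟩, ⟨fun j => y (Sum.inr j), fun i => ?_⟩⟩
    · have := hy (Sum.inl i)
      erw [Fintype.sum_sum_type] at this
      simpa [PPSystem.conj, PPFormula.conj] using this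
    · have := hy (Sum.inr i)
      erw [Fintype.sum_sum_type] at this
      simpa [PPSystem.conj, PPFormula.conj] using this
  · rintro ⟨⟨y, hy⟩, ⟨z, hz⟩⟩
    refine ⟨Sum.elim y z, ?_⟩
    rintro (i | i)
    · erw [Fintype.sum_sum_type]
      simpa [PPSystem.conj, PPFormula.conj] using hy i
    · erw [Fintype.sum_sum_type]
      simpa [PPSystem.conj, PPFormula.conj] using hz i

theorem PPFormula.sol_conj (φ ψ : PPFormula S) : (φ.conj ψ).sol N = φ.sol N ⊓ ψ.sol N := by
  ext x
  exact PPSystem.mem_sol_conj (p := ⟨φ, fun _ => (0 : N)⟩) (q := ⟨ψ, fun _ => 0⟩) |> fun h => by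
    have e : (⟨φ.conj ψ, fun _ => (0 : N)⟩ : PPSystem S N) =
        PPSystem.conj ⟨φ, fun _ => (0 : N)⟩ ⟨ψ, fun _ => 0⟩ := by
      have : (Sum.elim (fun _ => 0) fun _ => 0 : φ.eqn ⊕ ψ.eqn → N) = fun _ => 0 := by
        ext (i | i) <;> rfl
      simp only [PPSystem.conj, this]
      rfl
    rw [← e] at h
    exact h

theorem PPFormula.map_mem_sol (φ : PPFormula S) (f : N →ₗ[S] L) {x : N} (hx : x ∈ φ.sol N) :
    f x ∈ φ.sol L := by
  obtain ⟨y, hy⟩ := hx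
  exact ⟨fun j => f (y j), fun i => by simpa using congrArg f (hy i)⟩

theorem PPFormula.mem_sol_of_pure (φ : PPFormula S) {f : N →ₗ[S] L} (hf : IsPureEmbedding f) {x : N}
    (hx : f x ∈ φ.sol L) : x ∈ φ.sol N := by
  obtain ⟨y, hy⟩ := hx
  obtain ⟨z, hz⟩ := hf.exists_solution φ.coeff (fun i => -(φ.free i • x))
    ⟨y, fun i => by rw [map_neg, map_smul, eq_neg_iff_add_eq_zero, add_comm, hy]⟩
  exact ⟨z, fun i => by rw [hz, add_neg_cancel]⟩

theorem PPFormula.mem_sol_pi (φ : PPFormula S) {I : Type u} {N : I → Type u}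
    [∀ i, AddCommGroup (N i)] [∀ i, Module S (N i)] {x : ∀ i, N i} :
    x ∈ φ.sol (∀ i, N i) ↔ ∀ i, x i ∈ φ.sol (N i) := by
  constructor
  · intro h i
    exact φ.map_mem_sol (LinearMap.proj (φ := N) i) h
  · intro h
    choose y hy using h
    exact ⟨fun j i => y i j, fun k => funext fun i => by simpa using hy i k⟩

/-- `N` is algebraically compact: a family of positive primitive formulas with parameters in `N`
which is closed under conjunction, and each of which has a solution in `N`, has a common solution
in `N`. -/
def IsAlgebraicallyCompact (S : Type u) [Ring S] (N : Type u) [AddCommGroup N] [Module S N] :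
    Prop :=
  ∀ Φ : Set (PPSystem S N), Φ.Nonempty → (∀ p ∈ Φ, ∀ q ∈ Φ, p.conj q ∈ Φ) →
    (∀ p ∈ Φ, p.sol.Nonempty) → ∃ x, ∀ p ∈ Φ, x ∈ p.sol

/-- The descending chain condition on subgroups of `N` defined by positive primitive formulas, in
the form: every set of formulas closed under conjunction contains one with the least subgroup. -/
def PPDescending (S : Type u) [Ring S] (N : Type u) [AddCommGroup N] [Module S N] : Prop :=
  ∀ Φ : Set (PPFormula S), Φ.Nonempty → (∀ φ ∈ Φ, ∀ ψ ∈ Φ, φ.conj ψ ∈ Φ) →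
    ∃ φ ∈ Φ, ∀ ψ ∈ Φ, φ.sol N ≤ ψ.sol N

theorem PPSystem.mem_sol_of_sub_mem {p : PPSystem S N} {x y : N} (hx : x ∈ p.sol)
    (h : y - x ∈ p.toPPFormula.sol N) : y ∈ p.sol := by
  obtain ⟨a, ha⟩ := hx
  obtain ⟨b, hb⟩ := h
  refine ⟨a + b, fun i => ?_⟩
  rw [← ha i, ← add_zero (p.free i • x + _), ← hb i]
  simp only [Pi.add_apply, smul_add, Finset.sum_add_distrib, smul_sub]
  abel

theorem PPSystem.sub_mem_sol {p : PPSystem S N} {x y : N} (hx : x ∈ p.sol) (hy : y ∈ p.sol) :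
    y - x ∈ p.toPPFormula.sol N := by
  obtain ⟨a, ha⟩ := hx
  obtain ⟨b, hb⟩ := hy
  refine ⟨b - a, fun i => ?_⟩
  rw [← sub_eq_zero.mpr ((hb i).trans (ha i).symm)]
  simp only [Pi.sub_apply, smul_sub, Finset.sum_sub_distrib]
  abel

theorem PPDescending.isAlgebraicallyCompact (h : PPDescending S N) :
    IsAlgebraicallyCompact S N := by
  intro Φ hne hconj hsol
  obtain ⟨_, ⟨p, hp, rfl⟩, hmin⟩ := h (PPSystem.toPPFormula '' Φ) (hne.image _) (by
    rintro _ ⟨p, hp, rfl⟩ _ ⟨q, hq, rfl⟩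
    exact ⟨_, hconj p hp q hq, rfl⟩)
  obtain ⟨x, hx⟩ := hsol p hp
  refine ⟨x, fun q hq => ?_⟩
  obtain ⟨y, hy⟩ := hsol _ (hconj p hp q hq)
  rw [PPSystem.mem_sol_conj] at hy
  exact PPSystem.mem_sol_of_sub_mem hy.2
    (hmin _ ⟨q, hq, rfl⟩ (PPSystem.sub_mem_sol hy.1 hx))

end PPFormula

section Extension

/-! ### Algebraically compact modules are pure-injective -/

variable {S : Type u} [Ring S] {B N : Type u} [AddCommGroup B] [Module S B] [AddCommGroup N]
  [Module S N]

/-- A partial homomorphism `h` from `B` to `N` preserves solvability if every finite system of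
linear equations with constants in the domain of `h` which is solvable in `B` becomes solvable in
`N` once `h` is applied to the constants. -/
def PreservesSolvability (h : B →ₗ.[S] N) : Prop :=
  ∀ (ι κ : Type) [Fintype ι] [Fintype κ] (r : ι → κ → S) (a : ι → h.domain),
    (∃ x : κ → B, ∀ i, ∑ j, r i j • x j = a i) → ∃ y : κ → N, ∀ i, ∑ j, r i j • y j = h (a i)

theorem PreservesSolvability.exists_upperBound {c : Set (B →ₗ.[S] N)}
    (hc : ∀ h ∈ c, PreservesSolvability h) (hchain : IsChain (· ≤ ·) c) (hne : c.Nonempty) :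
    ∃ k : B →ₗ.[S] N, PreservesSolvability k ∧ ∀ h ∈ c, h ≤ k := by
  have hdir : DirectedOn (· ≤ ·) c := hchain.directedOn
  refine ⟨LinearPMap.sSup c hdir, ?_, fun h hh => LinearPMap.le_sSup hdir hh⟩
  intro ι κ _ _ r a hx
  have hmem (i : ι) : ∃ h : c, (a i : B) ∈ h.1.domain := by
    obtain ⟨h, hh, hm⟩ := (LinearPMap.mem_domain_sSup_iff hne hdir).1 (a i).2
    exact ⟨⟨h, hh⟩, hm⟩
  choose h hm using hmem
  have : Nonempty c := hne.to_subtype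
  have : IsDirectedOrder c := ⟨hdir.directed_val⟩
  obtain ⟨k, hk⟩ := Finite.exists_le h
  have hkd (i : ι) : (a i : B) ∈ k.1.domain := (hk i).1 (hm i)
  obtain ⟨y, hy⟩ := hc k.1 k.2 ι κ r (fun i => ⟨a i, hkd i⟩) hx
  refine ⟨y, fun i => (hy i).trans ?_⟩
  exact (LinearPMap.le_sSup hdir k.2).2 rfl

/-- Over an algebraically compact module, a partial homomorphism that preserves solvability
extends to one more element `b`: the image of `b` has to solve all formulas with parameters that
`b` itself satisfies, and these formulas are closed under conjunction. -/
theorem PreservesSolvability.exists_extension (hN : IsAlgebraicallyCompact S N) {h : B →ₗ.[S] N}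
    (hh : PreservesSolvability h) (b : B) :
    ∃ k : B →ₗ.[S] N, PreservesSolvability k ∧ h ≤ k ∧ b ∈ k.domain := by
  let Φ : Set (PPSystem S N) := {p | ∃ c : p.eqn → h.domain, (∀ i, p.const i = h (c i)) ∧
    ∃ y : p.var → B, ∀ i, p.free i • b + ∑ j, p.coeff i j • y j = c i}
  have hne : Φ.Nonempty := ⟨⟨⟨Empty, Empty, fun i => i.elim, fun i => i.elim⟩, fun i => i.elim⟩,
    fun i => i.elim, fun i => i.elim, fun i => i.elim, fun i => i.elim⟩
  have hconj : ∀ p ∈ Φ, ∀ q ∈ Φ, p.conj q ∈ Φ := by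
    rintro p ⟨c, hc, y, hy⟩ q ⟨d, hd, z, hz⟩
    refine ⟨Sum.elim c d, ?_, Sum.elim y z, ?_⟩
    · rintro (i | i)
      · exact hc i
      · exact hd i
    · rintro (i | i)
      · erw [Fintype.sum_sum_type]
        simpa [PPSystem.conj, PPFormula.conj] using hy i
      · erw [Fintype.sum_sum_type]
        simpa [PPSystem.conj, PPFormula.conj] using hz i
  have hsol : ∀ p ∈ Φ, p.sol.Nonempty := by
    rintro p ⟨c, hc, y, hy⟩
    obtain ⟨z, hz⟩ := hh p.eqn (Option p.var) (fun i => fun | none => p.free i | some j => p.coeff i j)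
      c ⟨fun | none => b | some j => y j, fun i => by
        rw [Fintype.sum_option, hy i]⟩
    refine ⟨z none, fun j => z (some j), fun i => ?_⟩
    rw [hc, ← hz i, Fintype.sum_option]
  obtain ⟨n, hn⟩ := hN Φ hne hconj hsol
  -- The formulas without bound variables determine `n` on multiples of `b` lying in the domain.
  have key (s : S) (d : h.domain) (hd : s • b = d) : s • n = h d := by
    obtain ⟨y, hy⟩ := hn ⟨⟨Unit, Empty, fun _ j => j.elim, fun _ => s⟩, fun _ => h d⟩
      ⟨fun _ => d, fun _ => rfl, fun j => j.elim, fun _ => by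
        erw [Finset.sum_of_isEmpty]; simpa using hd⟩
    have := hy ()
    erw [Finset.sum_of_isEmpty] at this
    simpa using this
  let g : B →ₗ.[S] N := LinearPMap.mkSpanSingleton' b n fun s hs => by
    have := key s 0 (by simpa using hs)
    simpa using this
  have hg (s : S) (hs : s • b ∈ g.domain) : g ⟨s • b, hs⟩ = s • n :=
    LinearPMap.mkSpanSingleton'_apply b n _ s hs
  have hcompat : ∀ (x : h.domain) (y : g.domain), (x : B) = y → h x = g y := by
    rintro x ⟨y, hy⟩ hxy
    obtain ⟨s, rfl⟩ := Submodule.mem_span_singleton.1 hy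
    exact (key s x hxy.symm).symm.trans (hg s hy).symm
  refine ⟨h.sup g hcompat, ?_, LinearPMap.left_le_sup _ _ _,
    (LinearPMap.right_le_sup h g hcompat).1 (Submodule.mem_span_singleton_self b)⟩
  intro ι κ _ _ r a ⟨x, hx⟩
  have hdecomp (i : ι) : ∃ (c : h.domain) (s : S), (a i : B) = c + s • b := by
    obtain ⟨c, hc, d, hd, hcd⟩ := Submodule.mem_sup.1 (a i).2
    obtain ⟨s, rfl⟩ := Submodule.mem_span_singleton.1 hd
    exact ⟨⟨c, hc⟩, s, hcd.symm⟩
  choose c s hcs using hdecomp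
  obtain ⟨y, hy⟩ := hn ⟨⟨ι, κ, r, fun i => -s i⟩, fun i => h (c i)⟩
    ⟨c, fun _ => rfl, x, fun i => by
      change -s i • b + ∑ j, r i j • x j = _
      rw [hx, hcs]; simp⟩
  refine ⟨y, fun i => ?_⟩
  have hmem : s i • b ∈ g.domain := Submodule.smul_mem _ _ (Submodule.mem_span_singleton_self b)
  rw [LinearPMap.sup_apply hcompat (c i) ⟨s i • b, hmem⟩ (a i) (hcs i).symm, hg]
  have := hy i
  change -s i • n + ∑ j, r i j • y j = h (c i) at this
  rw [← this]; simp

theorem IsAlgebraicallyCompact.isPureInjective {N : ModuleCat.{u} S}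
    (hN : IsAlgebraicallyCompact S N) : IsPureInjective N := by
  intro A B f hf g
  let e : A ≃ₗ[S] LinearMap.range f := LinearEquiv.ofInjective f hf.injective
  let h₀ : B →ₗ.[S] N := ⟨LinearMap.range f, g ∘ₗ e.symm.toLinearMap⟩
  have he (x : A) (hx : f x ∈ h₀.domain) : h₀ ⟨f x, hx⟩ = g x :=
    congrArg g (e.symm_apply_apply x)
  have hh₀ : PreservesSolvability h₀ := by
    intro ι κ _ _ r a hx
    have (i : ι) : ∃ x : A, f x = a i := (a i).2
    choose b hb using this
    obtain ⟨y, hy⟩ := hf.exists_solution r b (by simpa only [hb] using hx)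
    refine ⟨fun j => g (y j), fun i => ?_⟩
    have h1 : h₀ (a i) = g (b i) :=
      (congrArg h₀ (Subtype.ext (hb i).symm)).trans (he (b i) ⟨b i, rfl⟩)
    rw [h1, ← hy i]
    simp
  obtain ⟨k, hk, hmax⟩ := zorn_le_nonempty₀ {h : B →ₗ.[S] N | PreservesSolvability h}
    (fun c hc hchain y hy => PreservesSolvability.exists_upperBound (fun h hh => hc hh) hchain
      ⟨y, hy⟩) h₀ hh₀
  have htop (b : B) : b ∈ k.domain := by
    obtain ⟨k', hk', hle, hb⟩ := PreservesSolvability.exists_extension hN hmax.prop b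
    exact (hmax.le_of_ge hk' hle).1 hb
  refine ⟨⟨⟨fun b => k ⟨b, htop b⟩, fun b c => ?_⟩, fun s b => ?_⟩, LinearMap.ext fun x => ?_⟩
  · exact k.map_add ⟨b, htop b⟩ ⟨c, htop c⟩
  · exact k.map_smul s ⟨b, htop b⟩
  · exact (hk.2 (x := ⟨f x, x, rfl⟩) rfl).symm.trans (he x _)

theorem PPDescending.isPureInjective {N : ModuleCat.{u} S} (hN : PPDescending S N) :
    IsPureInjective N :=
  hN.isAlgebraicallyCompact.isPureInjective

end Extension

section SigmaPureInjective

/-! ### The chain condition in `Σ`-pure-injective modules -/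

variable {S : Type u} [Ring S]

/-- In a `Σ`-pure-injective module a descending sequence of subgroups defined by positive primitive
formulas is not strictly descending. If `x k` lies in the `k`-th subgroup but not in the next one,
then the image of `x` under a retraction of `N^ℕ` onto `N^(ℕ)` cannot have finite support. -/
theorem IsSigmaPureInjective.exists_sol_le {N : ModuleCat.{u} S} (hN : IsSigmaPureInjective N)
    (φ : ℕ → PPFormula S) (hφ : ∀ m n, m ≤ n → (φ n).sol N ≤ (φ m).sol N) :
    ∃ n, (φ n).sol N ≤ (φ (n + 1)).sol N := by
  classical
  by_contra! hcon
  choose x hx hx' using fun n => SetLike.not_le_iff_exists.1 (hcon n)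
  let I := ULift.{u} ℕ
  obtain ⟨ρ, hρ⟩ := (hN I).exists_retraction (N := ModuleCat.of S (I → N))
    (Finsupp.lcoeFun : (I →₀ N) →ₗ[S] I → N) (isPureEmbedding_finsupp_pi I)
  let X : I → N := fun k => x k.down
  let z : I →₀ N := ρ X
  obtain ⟨k, hk⟩ := Infinite.exists_notMem_finset z.support
  let t : I →₀ N := Finsupp.onFinset ((Finset.range (k.down + 1)).map
    (Equiv.ulift.{u}.symm.toEmbedding)) (fun i => if i.down ≤ k.down then X i else 0) fun i hi => by
      have : i.down ≤ k.down := by by_contra h; exact hi (if_neg h)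
      simp only [Finset.mem_map, Finset.mem_range]
      exact ⟨i.down, by omega, rfl⟩
  -- The coordinates of `X - t` vanish up to `k` and lie in the subgroup number `k + 1` beyond.
  have htail : X - ⇑t ∈ (φ (k.down + 1)).sol (I → N) := by
    rw [PPFormula.mem_sol_pi]
    intro i
    by_cases h : i.down ≤ k.down
    · have : (X - ⇑t) i = 0 := by simp [t, show i ≤ k from h]
      rw [this]; exact zero_mem _
    · have : (X - ⇑t) i = x i.down := by simp [t, show ¬ i ≤ k from h, X]
      rw [this]; exact hφ _ _ (by omega) (hx i.down)
  have h1 : (ρ (X - ⇑t) : I →₀ N) ∈ (φ (k.down + 1)).sol (I →₀ N) :=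
    (φ (k.down + 1)).map_mem_sol ρ htail
  have h2 : (ρ (X - ⇑t) : I →₀ N) = z - t := by
    have := LinearMap.congr_fun hρ t
    exact (map_sub ρ X ⇑t).trans (congrArg (z - ·) this)
  have h3 := (φ (k.down + 1)).map_mem_sol (Finsupp.lapply k : (I →₀ N) →ₗ[S] N) h1
  rw [h2, map_sub] at h3
  -- The `k`-th coordinate of `z - t` is `-x k`, which does not lie in this subgroup.
  have h4 : z k = 0 := Finsupp.notMem_support_iff.1 hk
  have h5 : (Finsupp.lapply k : (I →₀ N) →ₗ[S] N) z - (Finsupp.lapply k : (I →₀ N) →ₗ[S] N) t =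
      -x k.down := by
    simp [h4, t, X]
  rw [h5, neg_mem_iff] at h3
  exact hx' _ h3

end SigmaPureInjective

section Characters

/-! ### Character modules and dual formulas -/

/-- As `ℚ/ℤ` is injective, a character that vanishes on the kernel of `T` factors through `T`. -/
theorem exists_character_comp_eq {A B : Type u} [AddCommGroup A] [AddCommGroup B] (T : A →+ B)
    (α : A →+ AddCircle (1 : ℚ)) (h : ∀ a, T a = 0 → α a = 0) :
    ∃ β : B →+ AddCircle (1 : ℚ), ∀ a, β (T a) = α a := by
  let T' : (A ⧸ T.ker) →+ B := QuotientAddGroup.kerLift T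
  have hT' : Function.Injective T' := QuotientAddGroup.kerLift_injective T
  obtain ⟨β, hβ⟩ := CharacterModule.dual_surjective_of_injective (R := ℤ) T'.toIntLinearMap hT'
    (QuotientAddGroup.lift T.ker α fun a ha => h a ha : (A ⧸ T.ker) →+ _)
  exact ⟨β, fun a => DFunLike.congr_fun hβ (QuotientAddGroup.mk a)⟩

variable {R : Type u} [Ring R] {M : Type u} [AddCommGroup M] [Module R M]

theorem sum_character_apply {κ : Type*} (s : Finset κ) (f : κ → CharacterModule M) (x : M) :
    (∑ j ∈ s, f j) x = ∑ j ∈ s, f j x :=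
  map_sum (AddMonoidHom.eval x : (M →+ AddCircle (1 : ℚ)) →+ AddCircle (1 : ℚ)) f s

theorem character_sub_apply (f g : CharacterModule M) (x : M) : (f - g) x = f x - g x := rfl

/-- A finite system of linear equations is solvable in the dual of `M` if and only if the
constants respect the linear relations that its coefficients impose on elements of `M`. -/
theorem exists_character_solution_iff {ι κ : Type} [Fintype ι] [Fintype κ] (r : ι → κ → Rᵐᵒᵖ)
    (a : ι → CharacterModule M) :
    (∃ y : κ → CharacterModule M, ∀ i, ∑ j, r i j • y j = a i) ↔
      ∀ z : ι → M, (∀ j, ∑ i, (r i j).unop • z i = 0) → ∑ i, a i (z i) = 0 := by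
  classical
  constructor
  · rintro ⟨y, hy⟩ z hz
    calc ∑ i, a i (z i) = ∑ i, ∑ j, y j ((r i j).unop • z i) := by
          refine Finset.sum_congr rfl fun i _ => ?_
          rw [← hy i, sum_character_apply]
          rfl
      _ = ∑ j, y j (∑ i, (r i j).unop • z i) := by
          rw [Finset.sum_comm]
          exact Finset.sum_congr rfl fun j _ => (map_sum (y j) _ _).symm
      _ = 0 := Finset.sum_eq_zero fun j _ => by rw [hz j, map_zero]
  · intro h
    let T : (ι → M) →+ (κ → M) :=
      { toFun := fun z j => ∑ i, (r i j).unop • z i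
        map_zero' := by ext; simp
        map_add' := fun z w => by ext; simp [Finset.sum_add_distrib] }
    let α : (ι → M) →+ AddCircle (1 : ℚ) :=
      { toFun := fun z => ∑ i, a i (z i)
        map_zero' := by simp
        map_add' := fun z w => by simp [Finset.sum_add_distrib] }
    obtain ⟨β, hβ⟩ := exists_character_comp_eq T α fun z hz => h z fun j => congrFun hz j
    refine ⟨fun j => β.comp (AddMonoidHom.single (fun _ => M) j),
      fun i => CharacterModule.ext M fun x => ?_⟩
    rw [sum_character_apply]
    have h1 := hβ (Pi.single i x)
    have h2 : α (Pi.single i x) = a i x := by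
      change ∑ k, a k ((Pi.single i x : ι → M) k) = _
      rw [Finset.sum_eq_single i (fun k _ hk => by simp [hk]) (by simp)]
      simp
    have h3 : T (Pi.single i x) = ∑ j, Pi.single j ((r i j).unop • x) := by
      ext j
      change ∑ k, (r k j).unop • (Pi.single i x : ι → M) k = _
      rw [Finset.sum_eq_single i (fun k _ hk => by simp [hk]) (by simp)]
      simp
    rw [← h2, ← h1, h3, map_sum]
    rfl

/-- The dual formula, evaluated in `M`: the subgroup of all `∑ i, s i • z i`, where `z` runs
through the solutions of `∑ i, r i j • z i = 0`, if the formula has the coefficients `r` and `s`. It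
annihilates, and is annihilated by, the subgroup defined by the formula in the dual of `M`. -/
def PPFormula.dualSol (φ : PPFormula Rᵐᵒᵖ) (M : Type u) [AddCommGroup M] [Module R M] :
    AddSubgroup M where
  carrier := {x | ∃ z : φ.eqn → M, (∀ j, ∑ i, (φ.coeff i j).unop • z i = 0) ∧
    ∑ i, (φ.free i).unop • z i = x}
  zero_mem' := ⟨0, by simp, by simp⟩
  add_mem' := by
    rintro a b ⟨y, hy, rfl⟩ ⟨z, hz, rfl⟩
    exact ⟨y + z, fun j => by simp [Finset.sum_add_distrib, hy, hz], by
      simp [Finset.sum_add_distrib]⟩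
  neg_mem' := by
    rintro a ⟨y, hy, rfl⟩
    exact ⟨-y, fun j => by simp [hy], by simp⟩

theorem PPSystem.mem_sol_character_iff (p : PPSystem Rᵐᵒᵖ (CharacterModule M))
    (f : CharacterModule M) : f ∈ p.sol ↔
      ∀ z : p.eqn → M, (∀ j, ∑ i, (p.coeff i j).unop • z i = 0) →
        f (∑ i, (p.free i).unop • z i) = ∑ i, p.const i (z i) := by
  have h1 : f ∈ p.sol ↔ ∃ y : p.var → CharacterModule M,
      ∀ i, ∑ j, p.coeff i j • y j = p.const i - p.free i • f :=
    exists_congr fun y => forall_congr' fun i => by rw [eq_sub_iff_add_eq, add_comm]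
  rw [h1, exists_character_solution_iff]
  refine forall_congr' fun z => imp_congr_right fun _ => ?_
  simp only [character_sub_apply, Finset.sum_sub_distrib, sub_eq_zero, map_sum]
  exact eq_comm

theorem PPFormula.mem_sol_character_iff (φ : PPFormula Rᵐᵒᵖ) (f : CharacterModule M) :
    f ∈ φ.sol (CharacterModule M) ↔ ∀ x ∈ φ.dualSol M, f x = 0 := by
  refine (PPSystem.mem_sol_character_iff ⟨φ, fun _ => 0⟩ f).trans ⟨?_, fun h z hz => ?_⟩
  · rintro h _ ⟨z, hz, rfl⟩
    rw [h z hz]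
    exact Finset.sum_eq_zero fun _ _ => rfl
  · rw [h _ ⟨z, hz, rfl⟩]
    exact (Finset.sum_eq_zero fun _ _ => rfl).symm

/-- Passing to annihilators reflects inclusions, because `ℚ/ℤ` is a cogenerator. -/
theorem PPFormula.sol_character_le_iff (φ ψ : PPFormula Rᵐᵒᵖ) :
    φ.sol (CharacterModule M) ≤ ψ.sol (CharacterModule M) ↔ ψ.dualSol M ≤ φ.dualSol M := by
  constructor
  · intro h x hx
    by_contra hx'
    obtain ⟨c, hc⟩ := CharacterModule.exists_character_apply_ne_zero_of_ne_zero
      (a := (QuotientAddGroup.mk x : M ⧸ φ.dualSol M))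
      (fun h0 => hx' ((QuotientAddGroup.eq_zero_iff x).1 h0))
    let f : CharacterModule M := AddMonoidHom.comp (c : (M ⧸ φ.dualSol M) →+ AddCircle (1 : ℚ))
      (QuotientAddGroup.mk' (φ.dualSol M))
    have hf : f ∈ φ.sol (CharacterModule M) := by
      rw [PPFormula.mem_sol_character_iff]
      intro y hy
      have h0 : (QuotientAddGroup.mk' (φ.dualSol M)) y = 0 := (QuotientAddGroup.eq_zero_iff y).2 hy
      exact (congrArg c h0).trans (map_zero c)
    exact hc ((PPFormula.mem_sol_character_iff ψ f).1 (h hf) x hx)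
  · intro h f hf
    rw [PPFormula.mem_sol_character_iff] at hf ⊢
    exact fun x hx => hf x (h hx)

/-- The dual of a module is algebraically compact. The formulas in the given family prescribe the
values of a character on a directed union of subgroups, and `ℚ/ℤ` is injective. -/
theorem isAlgebraicallyCompact_character :
    IsAlgebraicallyCompact Rᵐᵒᵖ (CharacterModule M) := by
  intro Φ hne hconj hsol
  -- The pairs of an element of `M` and the value that some formula of the family prescribes on it.
  let G : AddSubgroup (M × AddCircle (1 : ℚ)) :=
    { carrier := {t | ∃ p ∈ Φ, ∃ z : p.eqn → M, (∀ j, ∑ i, (p.coeff i j).unop • z i = 0) ∧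
        ∑ i, (p.free i).unop • z i = t.1 ∧ ∑ i, p.const i (z i) = t.2}
      zero_mem' := by
        obtain ⟨p, hp⟩ := hne
        exact ⟨p, hp, 0, by simp, by simp, by simp⟩
      add_mem' := by
        rintro _ _ ⟨p, hp, z, hz, hz1, hz2⟩ ⟨q, hq, w, hw, hw1, hw2⟩
        refine ⟨_, hconj p hp q hq, Sum.elim z w, ?_, ?_, ?_⟩
        · rintro (j | j)
          · erw [Fintype.sum_sum_type]
            simpa [PPSystem.conj, PPFormula.conj] using hz j
          · erw [Fintype.sum_sum_type]
            simpa [PPSystem.conj, PPFormula.conj] using hw j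
        · erw [Fintype.sum_sum_type]
          exact congrArg₂ (· + ·) hz1 hw1
        · erw [Fintype.sum_sum_type]
          exact congrArg₂ (· + ·) hz2 hw2
      neg_mem' := by
        rintro _ ⟨p, hp, z, hz, hz1, hz2⟩
        exact ⟨p, hp, -z, fun j => by simp [hz], by simp [hz1], by simp [hz2]⟩ }
  have hG : ∀ t : G, t.1.1 = 0 → t.1.2 = 0 := by
    rintro ⟨t, p, hp, z, hz, hz1, hz2⟩ ht
    obtain ⟨f, hf⟩ := hsol p hp
    have := (PPSystem.mem_sol_character_iff p f).1 hf z hz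
    rw [hz1, hz2] at this
    change t.1 = 0 at ht
    rw [ht, map_zero] at this
    exact this.symm
  obtain ⟨β, hβ⟩ := exists_character_comp_eq ((AddMonoidHom.fst _ _).comp G.subtype)
    ((AddMonoidHom.snd _ _).comp G.subtype) hG
  exact ⟨β, fun p hp => (PPSystem.mem_sol_character_iff p β).2 fun z hz =>
    hβ ⟨(_, _), p, hp, z, hz, rfl, rfl⟩⟩

theorem isPureInjective_dual (M : ModuleCat.{u} R) : IsPureInjective (dual M) :=
  isAlgebraicallyCompact_character.isPureInjective

/-- The homomorphism of right modules dual to a homomorphism of left modules. -/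
def dualMap {M N : Type u} [AddCommGroup M] [Module R M] [AddCommGroup N] [Module R N]
    (f : M →ₗ[R] N) : CharacterModule N →ₗ[Rᵐᵒᵖ] CharacterModule M where
  toFun c := AddMonoidHom.comp (c : N →+ AddCircle (1 : ℚ)) f.toAddMonoidHom
  map_add' _ _ := rfl
  map_smul' r c := CharacterModule.ext M fun x => congrArg c (map_smul f r.unop x).symm

theorem dualMap_apply {M N : Type u} [AddCommGroup M] [Module R M] [AddCommGroup N] [Module R N]
    (f : M →ₗ[R] N) (c : CharacterModule N) (x : M) : dualMap f c x = c (f x) := rfl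

/-- The dual of an isomorphism. -/
def dualEquiv {M N : Type u} [AddCommGroup M] [Module R M] [AddCommGroup N] [Module R N]
    (e : M ≃ₗ[R] N) : CharacterModule N ≃ₗ[Rᵐᵒᵖ] CharacterModule M :=
  LinearEquiv.ofLinearMap (dualMap e.toLinearMap) (dualMap e.symm.toLinearMap)
    (LinearMap.ext fun c => CharacterModule.ext M fun x => congrArg c (e.symm_apply_apply x))
    (LinearMap.ext fun c => CharacterModule.ext N fun x => congrArg c (e.apply_symm_apply x))

/-- The dual of a direct sum is the direct product of the duals. -/
theorem nonempty_dual_directSum_equiv {ι : Type u} (X : ι → ModuleCat.{u} R) :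
    Nonempty (dual (ModuleCat.of R (DirectSum ι fun i => X i)) ≃ₗ[Rᵐᵒᵖ] ∀ i, dual (X i)) := by
  classical
  let g : (∀ i, X i →+ AddCircle (1 : ℚ)) → (DirectSum ι fun i => X i) →+ AddCircle (1 : ℚ) :=
    fun c => DirectSum.toAddMonoid c
  have hg (c : ∀ i, X i →+ AddCircle (1 : ℚ)) (i : ι) (x : X i) :
      g c (DirectSum.of (fun i => X i) i x) = c i x := DirectSum.toAddMonoid_of c i x
  refine ⟨{ LinearMap.pi (fun i => dualMap (DirectSum.lof R ι (fun i => X i) i)) with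
    invFun := g, left_inv := fun c => ?_, right_inv := fun c => ?_ }⟩
  · exact DirectSum.addHom_ext fun i x => hg _ i x
  · exact funext fun i => CharacterModule.ext _ fun x => hg _ i x

end Characters

section Presentation

/-! ### Finitely presented modules -/

variable {R : Type u} [Ring R]

/-- A finite presentation, described by what it says about homomorphisms: families of elements
satisfying the relations are the images of the generators. -/
theorem exists_generators_relations (Q : Type u) [AddCommGroup Q] [Module R Q]
    [Module.FinitePresentation R Q] :
    ∃ (n m : ℕ) (b : Fin n → Q) (c : Fin n → Fin m → R), Submodule.span R (Set.range b) = ⊤ ∧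
      ∀ (N : Type u) [AddCommGroup N] [Module R N] (z : Fin n → N),
        (∀ j, ∑ i, c i j • z i = 0) ↔ ∃ h : Q →ₗ[R] N, ∀ i, h (b i) = z i := by
  classical
  obtain ⟨n, m, f, g, hf, hfg⟩ := Module.FinitePresentation.exists_fin' R Q
  have hfx (x : Fin n → R) : f x = ∑ i, x i • f (Pi.single i 1) := by
    conv_lhs => rw [LinearMap.pi_apply_eq_sum_univ f x]
    refine Finset.sum_congr rfl fun i _ => ?_
    congr 2
    ext j
    simp [Pi.single_apply, eq_comm]
  refine ⟨n, m, fun i => f (Pi.single i 1), fun i j => g (Pi.single j 1) i, ?_, ?_⟩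
  · rw [eq_top_iff]
    rintro q -
    obtain ⟨x, rfl⟩ := hf q
    rw [hfx]
    exact Submodule.sum_mem _ fun i _ => Submodule.smul_mem _ _ (Submodule.subset_span ⟨i, rfl⟩)
  · intro N _ _ z
    constructor
    · intro hz
      let k : (Fin n → R) →ₗ[R] N := Fintype.linearCombination R z
      have hk (x : Fin n → R) : k x = ∑ i, x i • z i := Fintype.linearCombination_apply R z x
      have hkg : k ∘ₗ g = 0 := by
        refine LinearMap.pi_ext' fun j => LinearMap.ext_ring ?_
        simpa [hk] using hz j
      have hker : LinearMap.ker f ≤ LinearMap.ker k := by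
        intro x hx
        obtain ⟨y, rfl⟩ := (hfg x).1 hx
        exact LinearMap.congr_fun hkg y
      refine ⟨(LinearMap.ker f).liftQ k hker ∘ₗ (f.quotKerEquivOfSurjective hf).symm.toLinearMap,
        fun i => ?_⟩
      have h1 : (f.quotKerEquivOfSurjective hf).symm (f (Pi.single i 1)) =
          Submodule.Quotient.mk (Pi.single i 1) := by
        rw [LinearEquiv.symm_apply_eq]; rfl
      rw [LinearMap.comp_apply, LinearEquiv.coe_coe, h1]
      refine (Submodule.liftQ_apply _ k _).trans ?_
      rw [hk]
      rw [Finset.sum_eq_single i (fun j _ hj => by simp [hj]) (by simp)]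
      simp
    · rintro ⟨h, hh⟩ j
      simp only [← hh, ← map_smul h, ← map_sum]
      rw [← hfx, hfg.apply_apply_eq_zero, map_zero]

/-- For an element `q` of a finitely presented module `Q`, the images of `q` under all homomorphisms
from `Q` to a module form a subgroup defined by one formula, read off from a presentation. -/
theorem exists_dualSol_eq_image (Q : Type u) [AddCommGroup Q] [Module R Q]
    [Module.FinitePresentation R Q] (q : Q) :
    ∃ φ : PPFormula Rᵐᵒᵖ, ∀ (N : Type u) [AddCommGroup N] [Module R N] (x : N),
      x ∈ φ.dualSol N ↔ ∃ h : Q →ₗ[R] N, h q = x := by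
  obtain ⟨n, m, b, c, hb, hN⟩ := exists_generators_relations (R := R) Q
  obtain ⟨s, hs⟩ := (Submodule.mem_span_range_iff_exists_fun R).1
    (hb ▸ Submodule.mem_top : q ∈ Submodule.span R (Set.range b))
  refine ⟨⟨Fin n, Fin m, fun i j => MulOpposite.op (c i j), fun i => MulOpposite.op (s i)⟩,
    fun N _ _ x => ⟨?_, ?_⟩⟩
  · rintro ⟨z, hz, rfl⟩
    obtain ⟨h, hh⟩ := (hN N z).1 hz
    refine ⟨h, ?_⟩
    rw [← hs, map_sum]
    simp only [map_smul, hh]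
    rfl
  · rintro ⟨h, rfl⟩
    refine ⟨fun i => h (b i), (hN N _).2 ⟨h, fun _ => rfl⟩, ?_⟩
    rw [← hs, map_sum]
    simp only [map_smul]
    rfl

end Presentation

section Noetherian

/-! ### The endomorphism ring and the chain condition for the dual -/

variable {R : Type u} [Ring R]

theorem PPFormula.map_mem_dualSol (φ : PPFormula Rᵐᵒᵖ) {M N : Type u} [AddCommGroup M] [Module R M]
    [AddCommGroup N] [Module R N] (f : M →ₗ[R] N) {x : M} (hx : x ∈ φ.dualSol M) :
    f x ∈ φ.dualSol N := by
  obtain ⟨z, hz, rfl⟩ := hx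
  exact ⟨fun i => f (z i), fun j => by simpa using congrArg f (hz j), by simp⟩

/-- The subgroup defined by the dual formula as a submodule over the endomorphism ring. -/
def PPFormula.dualSubmodule (φ : PPFormula Rᵐᵒᵖ) (M : Type u) [AddCommGroup M] [Module R M] :
    Submodule (Module.End R M) M where
  __ := φ.dualSol M
  smul_mem' f _ hx := φ.map_mem_dualSol f hx

theorem ppDescending_character_of_isNoetherian (M : Type u) [AddCommGroup M] [Module R M]
    [IsNoetherian (Module.End R M) M] : PPDescending Rᵐᵒᵖ (CharacterModule M) := by
  intro Φ hne hconj
  obtain ⟨_, ⟨φ, hφ, rfl⟩, hmax⟩ := set_has_maximal_iff_noetherian.2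
    (inferInstanceAs (IsNoetherian (Module.End R M) M))
    ((fun φ => PPFormula.dualSubmodule φ M) '' Φ) (hne.image _)
  refine ⟨φ, hφ, fun ψ hψ => ?_⟩
  have h1 : φ.dualSubmodule M ≤ (φ.conj ψ).dualSubmodule M :=
    (PPFormula.sol_character_le_iff (M := M) (φ.conj ψ) φ).1 (by
      rw [PPFormula.sol_conj]; exact inf_le_left)
  have h2 : (φ.conj ψ).dualSubmodule M ≤ φ.dualSubmodule M := by
    by_contra hlt
    exact hmax _ ⟨_, hconj φ hφ ψ hψ, rfl⟩ (lt_of_le_not_ge h1 hlt)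
  have h3 := (PPFormula.sol_character_le_iff (M := M) φ (φ.conj ψ)).2 h2
  rw [PPFormula.sol_conj] at h3
  exact h3.trans inf_le_right

end Noetherian

section AdditiveSubcategory

/-! ### Direct sums of modules in an additive subcategory -/

variable {R : Type u} [Ring R] {B : ObjectProperty (ModuleCat.{u} R)}

theorem IsAdditiveFP.pi (hB : IsAdditiveFP B) {κ : Type u} [Finite κ] (P : κ → ModuleCat.{u} R)
    (hP : ∀ k, B (P k)) : B (ModuleCat.of R (∀ k, P k)) :=
  Module.pi_induction' R (motive := fun N _ _ => B (ModuleCat.of R N))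
    (motive' := fun N _ _ => B (ModuleCat.of R N)) (fun e h => hB.iso _ _ e h)
    (fun e h => hB.iso _ _ e h) hB.zero (fun h h' => hB.sum _ _ h h') (fun k => P k) hP

/-- Finitely many elements of a direct sum of modules in `B` lie in a direct summand in `B`. -/
theorem IsAdditiveFP.exists_summand (hB : IsAdditiveFP B) {ι : Type u} {X : ι → ModuleCat.{u} R}
    (hX : ∀ i, B (X i)) {κ : Type*} [Finite κ] (m : κ → DirectSum ι fun i => X i) :
    ∃ (P : ModuleCat.{u} R) (e : P →ₗ[R] DirectSum ι fun i => X i)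
      (p : (DirectSum ι fun i => X i) →ₗ[R] P), B P ∧ ∀ k, e (p (m k)) = m k := by
  classical
  cases nonempty_fintype κ
  let F : Finset ι := Finset.univ.biUnion fun k => DFinsupp.support (m k)
  refine ⟨ModuleCat.of R (∀ i : F, X i),
    ∑ i : F, DirectSum.lof R ι (fun i => X i) i ∘ₗ LinearMap.proj i,
    LinearMap.pi fun i : F => DirectSum.component R ι (fun i => X i) i,
    hB.pi _ fun i => hX i, fun k => ?_⟩
  have h1 : ∑ i ∈ DFinsupp.support (m k), DirectSum.of (fun i => X i) i (m k i) = m k :=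
    DirectSum.sum_support_of (m k)
  rw [LinearMap.sum_apply]
  refine Eq.trans ?_ h1
  refine (Finset.sum_coe_sort F fun i => DirectSum.of (fun i => X i) i (m k i)).trans ?_
  symm
  refine Finset.sum_subset (fun i hi => Finset.mem_biUnion.2 ⟨k, Finset.mem_univ _, hi⟩)
    fun i _ hi => ?_
  rw [show m k i = 0 from DFinsupp.notMem_support_iff.1 hi, map_zero]

/-- The finitely generated submodules of the direct sum `M` over `End M` are defined by formulas:
such a submodule consists of the images under all homomorphisms into `M` of one element of a
finitely presented module. -/
theorem IsAdditiveFP.exists_dualSubmodule_eq (hB : IsAdditiveFP B) {ι : Type u}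
    {X : ι → ModuleCat.{u} R} (hX : ∀ i, B (X i))
    (W : Submodule (Module.End R (DirectSum ι fun i => X i)) (DirectSum ι fun i => X i))
    (hW : W.FG) : ∃ φ : PPFormula Rᵐᵒᵖ, φ.dualSubmodule (DirectSum ι fun i => X i) = W := by
  classical
  obtain ⟨n, m, rfl⟩ := Submodule.fg_iff_exists_fin_generating_family.1 hW
  obtain ⟨P, e, p, hP, hep⟩ := hB.exists_summand hX m
  have := hB.finitePresentation P hP
  obtain ⟨φ, hφ⟩ := exists_dualSol_eq_image (R := R) (Fin n → P) fun l => p (m l)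
  refine ⟨φ, SetLike.ext fun x => (hφ _ x).trans ?_⟩
  rw [Submodule.mem_span_range_iff_exists_fun]
  constructor
  · rintro ⟨h, rfl⟩
    refine ⟨fun l => h ∘ₗ LinearMap.single R (fun _ => P) l ∘ₗ p, ?_⟩
    rw [← Finset.univ_sum_single (fun l => p (m l)), map_sum]
    rfl
  · rintro ⟨c, rfl⟩
    refine ⟨∑ l, c l ∘ₗ e ∘ₗ LinearMap.proj l, ?_⟩
    rw [LinearMap.sum_apply]
    exact Finset.sum_congr rfl fun l _ => congrArg (c l) (hep l)

theorem IsAdditiveFP.isNoetherian_of_isSigmaPureInjective (hB : IsAdditiveFP B) {ι : Type u}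
    {X : ι → ModuleCat.{u} R} (hX : ∀ i, B (X i))
    (h : IsSigmaPureInjective (dual (ModuleCat.of R (DirectSum ι fun i => X i)))) :
    IsNoetherian (Module.End R (DirectSum ι fun i => X i)) (DirectSum ι fun i => X i) := by
  rw [isNoetherian_iff_fg_wellFounded, wellFoundedGT_iff_monotone_chain_condition']
  intro W
  by_contra! hcon
  obtain ⟨g, hg, hlt⟩ : ∃ g : ℕ → ℕ, StrictMono g ∧ ∀ n, W (g n) < W (g (n + 1)) := by
    choose s hs hs' using hcon
    refine ⟨fun n => s^[n] 0, strictMono_nat_of_lt_succ fun n => ?_, fun n => ?_⟩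
    · rw [Function.iterate_succ_apply']
      refine lt_of_le_of_ne (hs _) fun h0 => ?_
      have := hs' (s^[n] 0)
      rw [← h0] at this
      exact lt_irrefl _ this
    · change W (s^[n] 0) < W (s^[n + 1] 0)
      rw [Function.iterate_succ_apply']
      exact hs' _
  -- Along `g` the submodules increase strictly, so the subgroups of the dual decrease strictly.
  choose φ hφ using fun n => hB.exists_dualSubmodule_eq hX (W (g n)).1 (W (g n)).2
  have hle (m n : ℕ) : (φ n).sol (dual (ModuleCat.of R (DirectSum ι fun i => X i))) ≤
      (φ m).sol (dual (ModuleCat.of R (DirectSum ι fun i => X i))) ↔ W (g m) ≤ W (g n) := by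
    refine (PPFormula.sol_character_le_iff (φ n) (φ m)).trans ?_
    change (φ m).dualSubmodule _ ≤ (φ n).dualSubmodule _ ↔ (W (g m)).1 ≤ (W (g n)).1
    rw [hφ, hφ]
  obtain ⟨n, hn⟩ := h.exists_sol_le φ fun m n hmn => (hle m n).2 (W.monotone (hg.monotone hmn))
  exact not_le_of_gt (hlt n) ((hle _ _).1 hn)

/-- If the direct sum `M` of the modules representing `B` is noetherian over its endomorphism
ring, then every finitely presented module has a left `B`-approximation. -/
theorem IsAdditiveFP.exists_leftApproximation (hB : IsAdditiveFP B) {ι : Type u}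
    {X : ι → ModuleCat.{u} R} (hX : ∀ i, B (X i))
    (hX' : ∀ N : ModuleCat.{u} R, B N → ∃ i, Nonempty (N ≃ₗ[R] X i))
    [hN : IsNoetherian (Module.End R (DirectSum ι fun i => X i)) (DirectSum ι fun i => X i)]
    (F : Type u) [AddCommGroup F] [Module R F] [Module.Finite R F] :
    ∃ (P : ModuleCat.{u} R) (a : F →ₗ[R] P), B P ∧
      ∀ (N : ModuleCat.{u} R), B N → ∀ h : F →ₗ[R] N, ∃ g : P →ₗ[R] N, g ∘ₗ a = h := by
  classical
  obtain ⟨n, b, hb⟩ := Submodule.fg_iff_exists_fin_generating_family.1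
    (Module.Finite.fg_top (R := R) (M := F))
  -- Homomorphisms from `F` to `M` are determined by their values on the generators `b`.
  let W : Submodule (Module.End R (DirectSum ι fun i => X i))
      (Fin n → DirectSum ι fun i => X i) :=
    { carrier := {z | ∃ h : F →ₗ[R] DirectSum ι fun i => X i, ∀ i, h (b i) = z i}
      zero_mem' := ⟨0, fun _ => rfl⟩
      add_mem' := by
        rintro _ _ ⟨h, hh⟩ ⟨k, hk⟩
        exact ⟨h + k, fun i => by simp [hh, hk]⟩
      smul_mem' := by
        rintro c _ ⟨h, hh⟩
        exact ⟨c ∘ₗ h, fun i => by simp [hh]⟩ }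
  obtain ⟨k, w, hw⟩ := Submodule.fg_iff_exists_fin_generating_family.1
    (IsNoetherian.noetherian W)
  have hwW (l : Fin k) : w l ∈ W := hw ▸ Submodule.subset_span ⟨l, rfl⟩
  choose h hh using hwW
  -- Generators `h l` of all homomorphisms from `F` to `M` have values in one summand `P`, and the
  -- approximation of `F` is the map to a power of `P` with the components `h l`.
  obtain ⟨P, e, p, hP, hep⟩ := hB.exists_summand hX fun t : Fin k × Fin n => w t.1 t.2
  have heph (l : Fin k) : e ∘ₗ p ∘ₗ h l = h l := by
    refine LinearMap.ext_on_range hb fun i => ?_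
    simp only [LinearMap.comp_apply, hh]
    exact hep (l, i)
  let a : F →ₗ[R] (ULift.{u} (Fin k) → P) := LinearMap.pi fun l => p ∘ₗ h l.down
  have hM (f : F →ₗ[R] DirectSum ι fun i => X i) :
      ∃ g : (ULift.{u} (Fin k) → P) →ₗ[R] DirectSum ι fun i => X i, g ∘ₗ a = f := by
    have hf : (fun i => f (b i)) ∈ W := ⟨f, fun _ => rfl⟩
    rw [← hw, Submodule.mem_span_range_iff_exists_fun] at hf
    obtain ⟨c, hc⟩ := hf
    refine ⟨∑ l, c l ∘ₗ e ∘ₗ LinearMap.proj (ULift.up l), LinearMap.ext_on_range hb fun i => ?_⟩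
    rw [← congrFun hc i, LinearMap.comp_apply, LinearMap.sum_apply, Finset.sum_apply]
    refine Finset.sum_congr rfl fun l _ => ?_
    change c l (e (p (h l (b i)))) = c l (w l i)
    rw [hh l i, hep (l, i)]
  refine ⟨ModuleCat.of R (ULift.{u} (Fin k) → P), a, hB.pi _ fun _ => hP, fun N hN f => ?_⟩
  obtain ⟨i, ⟨ε⟩⟩ := hX' N hN
  obtain ⟨g, hg⟩ := hM (DirectSum.lof R ι (fun i => X i) i ∘ₗ ε.toLinearMap ∘ₗ f)
  refine ⟨ε.symm.toLinearMap ∘ₗ DirectSum.component R ι (fun i => X i) i ∘ₗ g,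
    LinearMap.ext fun x => ?_⟩
  have := LinearMap.congr_fun hg x
  simp only [LinearMap.comp_apply] at this ⊢
  rw [this]
  simp [DirectSum.component.lof_self]

end AdditiveSubcategory

section DirectLimit

/-! ### Direct limits as pure quotients of direct sums -/

variable {S : Type u} [Ring S] {I : Type u} [Preorder I] [DecidableEq I]
  {G : I → ModuleCat.{u} S} {f : ∀ i j, i ≤ j → G i →ₗ[S] G j}

variable (G f) in
/-- The canonical map from the direct sum of the modules of a directed system to the limit. -/
noncomputable def directSumToLimit : (DirectSum I fun i => G i) →ₗ[S] Module.DirectLimit (fun i => G i) f :=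
  DirectSum.toModule S I _ fun i => Module.DirectLimit.of S I (fun i => G i) f i

variable (G f) in
open Classical in
/-- The map from the direct sum of the modules of a directed system to the stage `k` which is given
by the transition maps on the components `i ≤ k` and by zero on all others. -/
noncomputable def directSumToStage (k : I) : (DirectSum I fun i => G i) →ₗ[S] G k :=
  DirectSum.toModule S I _ fun i => if h : i ≤ k then f i k h else 0

theorem directSumToLimit_lof (i : I) (x : G i) :
    directSumToLimit G f (DirectSum.lof S I (fun i => G i) i x) =
      Module.DirectLimit.of S I (fun i => G i) f i x :=
  DirectSum.toModule_lof S (φ := fun i => Module.DirectLimit.of S I (fun i => G i) f i) i x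

open Classical in
theorem directSumToStage_lof {i k : I} (h : i ≤ k) (x : G i) :
    directSumToStage G f k (DirectSum.lof S I (fun i => G i) i x) = f i k h x := by
  refine (DirectSum.toModule_lof S (φ := fun i => if h : i ≤ k then f i k h else 0) i x).trans ?_
  rw [dif_pos h]

variable [IsDirectedOrder I] [Nonempty I]

theorem directSumToLimit_surjective : Function.Surjective (directSumToLimit G f) := by
  intro z
  obtain ⟨i, x, rfl⟩ := Module.DirectLimit.exists_of z
  exact ⟨DirectSum.lof S I (fun i => G i) i x, directSumToLimit_lof i x⟩

theorem exists_common_stage {κ : Type*} [Finite κ] (z : κ → Module.DirectLimit (fun i => G i) f) :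
    ∃ (i : I) (w : κ → G i), ∀ k, Module.DirectLimit.of S I (fun i => G i) f i (w k) = z k := by
  choose i w hw using fun k => Module.DirectLimit.exists_of (z k)
  obtain ⟨j, hj⟩ := Finite.exists_le i
  exact ⟨j, fun k => f (i k) j (hj k) (w k), fun k => by rw [Module.DirectLimit.of_f, hw]⟩

variable [DirectedSystem (fun i => G i) (fun i j h => f i j h)]

theorem exists_common_stage_eq_zero {κ : Type*} [Finite κ] {i : I} (v : κ → G i)
    (hv : ∀ k, Module.DirectLimit.of S I (fun i => G i) f i (v k) = 0) :
    ∃ (j : I) (hij : i ≤ j), ∀ k, f i j hij (v k) = 0 := by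
  choose j hj h0 using fun k => Module.DirectLimit.of.zero_exact (hv k)
  obtain ⟨l, hl⟩ := Finite.exists_le (fun o : Option κ => o.elim i j)
  have hil : i ≤ l := hl none
  have hjl (k : κ) : j k ≤ l := hl (some k)
  refine ⟨l, hil, fun k => ?_⟩
  have h1 : f (j k) l (hjl k) (f i (j k) (hj k) (v k)) = f i l hil (v k) :=
    DirectedSystem.map_map' f (hj k) (hjl k) (v k)
  rw [← h1, h0, map_zero]

/-- Elements of a direct limit that satisfy finitely many linear relations come from elements of
some stage that satisfy these relations. -/
theorem exists_stage_relations {ι κ : Type*} [Fintype ι] [Finite κ] (c : ι → κ → S)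
    (z : ι → Module.DirectLimit (fun i => G i) f) (hz : ∀ j, ∑ i, c i j • z i = 0) :
    ∃ (k : I) (w : ι → G k), (∀ i, Module.DirectLimit.of S I (fun i => G i) f k (w i) = z i) ∧
      ∀ j, ∑ i, c i j • w i = 0 := by
  obtain ⟨k, w, hw⟩ := exists_common_stage z
  obtain ⟨l, hkl, hl⟩ := exists_common_stage_eq_zero (f := f) (fun j => ∑ i, c i j • w i)
    fun j => by simp only [map_sum, map_smul, hw, hz]
  refine ⟨l, fun i => f k l hkl (w i), fun i => by rw [Module.DirectLimit.of_f, hw], fun j => ?_⟩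
  have := hl j
  simpa only [map_sum, map_smul] using this

theorem exists_stage_lift (F : Type u) [AddCommGroup F] [Module S F] [Module.FinitePresentation S F]
    (h : F →ₗ[S] Module.DirectLimit (fun i => G i) f) :
    ∃ (k : I) (g : F →ₗ[S] G k), Module.DirectLimit.of S I (fun i => G i) f k ∘ₗ g = h := by
  obtain ⟨n, m, b, c, hb, hN⟩ := exists_generators_relations (R := S) F
  obtain ⟨k, w, hw, hrel⟩ := exists_stage_relations c (fun i => h (b i))
    ((hN _ _).2 ⟨h, fun _ => rfl⟩)
  obtain ⟨g, hg⟩ := (hN _ w).1 hrel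
  exact ⟨k, g, LinearMap.ext_on_range hb fun i => by rw [LinearMap.comp_apply, hg, hw]⟩

theorem exists_directSumToStage_spec (d : DirectSum I fun i => G i) :
    ∃ k : I, ∀ l, k ≤ l →
      Module.DirectLimit.of S I (fun i => G i) f l (directSumToStage G f l d) =
        directSumToLimit G f d ∧
      ∀ n (h : l ≤ n), f l n h (directSumToStage G f l d) = directSumToStage G f n d := by
  induction d using DirectSum.induction_on with
  | zero =>
    obtain ⟨k⟩ := ‹Nonempty I›
    refine ⟨k, fun l _ => ?_⟩
    simp only [map_zero, implies_true, and_self]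
  | of i x =>
    have hs (l : I) (h : i ≤ l) :
        directSumToStage G f l (DirectSum.of (fun i => G i) i x) = f i l h x :=
      directSumToStage_lof h x
    have ht : directSumToLimit G f (DirectSum.of (fun i => G i) i x) =
        Module.DirectLimit.of S I (fun i => G i) f i x :=
      directSumToLimit_lof i x
    refine ⟨i, fun l hl => ⟨?_, fun n hn => ?_⟩⟩
    · rw [hs l hl, ht, Module.DirectLimit.of_f]
    · rw [hs l hl, hs n (hl.trans hn)]
      exact DirectedSystem.map_map' f hl hn x
  | add d e hd he =>
    obtain ⟨k, hk⟩ := hd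
    obtain ⟨k', hk'⟩ := he
    obtain ⟨l, hl, hl'⟩ := exists_ge_ge k k'
    refine ⟨l, fun n hn => ⟨?_, fun p hp => ?_⟩⟩
    · rw [map_add, map_add, map_add, (hk n (hl.trans hn)).1, (hk' n (hl'.trans hn)).1]
    · rw [map_add, map_add, map_add, (hk n (hl.trans hn)).2, (hk' n (hl'.trans hn)).2]

theorem exists_directSumToStage_eq_zero {d : DirectSum I fun i => G i}
    (hd : directSumToLimit G f d = 0) : ∃ k : I, ∀ l, k ≤ l → directSumToStage G f l d = 0 := by
  obtain ⟨k, hk⟩ := exists_directSumToStage_spec (f := f) d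
  obtain ⟨l, hkl, hl⟩ := Module.DirectLimit.of.zero_exact ((hk k le_rfl).1.trans hd)
  rw [(hk k le_rfl).2] at hl
  refine ⟨l, fun n hn => ?_⟩
  rw [← (hk l hkl).2 n hn, hl, map_zero]

/-- The direct limit is a pure quotient of the direct sum. A solution in the direct sum is moved
into the kernel by subtracting its image in a sufficiently late stage, where the constants
vanish. -/
theorem isPureEmbedding_ker_directSumToLimit :
    IsPureEmbedding (LinearMap.ker (directSumToLimit G f)).subtype where
  injective := Subtype.val_injective
  solvable m n r a := by
    rintro ⟨x, hx⟩
    choose k hk using fun j => exists_directSumToStage_spec (f := f) (x j)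
    choose l hl using fun i => exists_directSumToStage_eq_zero (a i).2
    obtain ⟨p, hp⟩ := Finite.exists_le (Sum.elim k l)
    have hmem (j : Fin n) : x j - DirectSum.lof S I (fun i => G i) p (directSumToStage G f p (x j)) ∈
        LinearMap.ker (directSumToLimit G f) := by
      rw [LinearMap.mem_ker, map_sub, ← (hk j p (hp (Sum.inl j))).1, sub_eq_zero]
      exact (directSumToLimit_lof p _).symm
    refine ⟨fun j => ⟨_, hmem j⟩, fun i => Subtype.ext ?_⟩
    have h0 : directSumToStage G f p (a i) = 0 := hl i p (hp (Sum.inr i))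
    have h1 : ∑ j, r i j • x j = a i := hx i
    simp only [Submodule.coe_sum, Submodule.coe_smul, smul_sub, Finset.sum_sub_distrib]
    rw [h1, sub_eq_self]
    simp only [← map_smul, ← map_sum]
    rw [h1, h0, map_zero]

end DirectLimit

section DualLimit

/-! ### The dual of a direct limit -/

variable {R : Type u} [Ring R] {I : Type u} [Preorder I] [IsDirectedOrder I] [Nonempty I]
  [DecidableEq I] {G : I → ModuleCat.{u} R} {f : ∀ i j, i ≤ j → G i →ₗ[R] G j}
  [DirectedSystem (fun i => G i) (fun i j h => f i j h)]

/-- The dual of a direct limit is pure in the product of the duals. -/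
theorem isPureEmbedding_dual_directLimit :
    IsPureEmbedding (LinearMap.pi (fun i => dualMap (Module.DirectLimit.of R I (fun i => G i) f i)) :
      CharacterModule (Module.DirectLimit (fun i => G i) f) →ₗ[Rᵐᵒᵖ]
        ∀ i, CharacterModule (G i)) where
  injective c d h := CharacterModule.ext _ fun z => by
    obtain ⟨i, x, rfl⟩ := Module.DirectLimit.exists_of z
    exact DFunLike.congr_fun (congrFun h i) x
  solvable m n r a := by
    rintro ⟨x, hx⟩
    rw [exists_character_solution_iff]
    intro z hz
    obtain ⟨k, w, hw, hrel⟩ := exists_stage_relations (fun i j => (r i j).unop) z hz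
    have := (exists_character_solution_iff r fun i =>
      dualMap (Module.DirectLimit.of R I (fun i => G i) f k) (a i)).1
      ⟨fun j => x j k, fun i => by simpa using congrFun (hx i) k⟩ w hrel
    simpa only [dualMap_apply, hw] using this

end DualLimit

section Lim

/-! ### Factorization through a class of finitely presented modules -/

variable {R : Type u} [Ring R]

/-- Every homomorphism from a finitely presented module to `N` factors through a module in `B`. -/
def FactorsThrough (B : ObjectProperty (ModuleCat.{u} R)) (N : ModuleCat.{u} R) : Prop :=
  ∀ (F : ModuleCat.{u} R) [Module.FinitePresentation R F] (h : F →ₗ[R] N),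
    ∃ (P : ModuleCat.{u} R) (a : F →ₗ[R] P) (b : P →ₗ[R] N), B P ∧ b ∘ₗ a = h

variable {B : ObjectProperty (ModuleCat.{u} R)} {N : ModuleCat.{u} R}

theorem LimClosure.factorsThrough (hN : LimClosure B N) : FactorsThrough B N := by
  induction hN with
  | base N h => exact fun F _ g => ⟨N, g, LinearMap.id, h, rfl⟩
  | directLimit G f _ ih =>
    intro F _ g
    obtain ⟨k, g', rfl⟩ := exists_stage_lift (f := f) F g
    obtain ⟨P, a, b, hP, rfl⟩ := ih k F g'
    exact ⟨P, a, _ ∘ₗ b, hP, LinearMap.comp_assoc _ _ _⟩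
  | iso N L e _ ih =>
    intro F _ g
    obtain ⟨P, a, b, hP, hab⟩ := ih F (e.symm.toLinearMap ∘ₗ g)
    refine ⟨P, a, e.toLinearMap ∘ₗ b, hP, ?_⟩
    rw [LinearMap.comp_assoc, hab]
    ext x
    simp

/-- A factorization over `N` is a solution of a finite system with constants in the pure submodule
`L`, so it can be replaced by a factorization over `L`. -/
theorem FactorsThrough.of_pure (hB : IsAdditiveFP B) (hN : FactorsThrough B N) {L : ModuleCat.{u} R}
    (i : L →ₗ[R] N) (hi : IsPureEmbedding i) : FactorsThrough B L := by
  intro F _ h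
  obtain ⟨P, a, b, hP, hab⟩ := hN F (i ∘ₗ h)
  have := hB.finitePresentation P hP
  obtain ⟨n, m, p, c, hp, hrel⟩ := exists_generators_relations (R := R) P
  obtain ⟨k, q, hq⟩ := Submodule.fg_iff_exists_fin_generating_family.1
    (Module.Finite.fg_top (R := R) (M := F))
  have hs (l : Fin k) : ∃ s : Fin n → R, ∑ j, s j • p j = a (q l) :=
    (Submodule.mem_span_range_iff_exists_fun R).1 (hp ▸ Submodule.mem_top)
  choose s hs using hs
  -- The relations of `P` together with the values prescribed on the generators of `F`.
  obtain ⟨y, hy⟩ := hi.exists_solution (ι := Fin m ⊕ Fin k) (κ := Fin n)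
    (Sum.elim (fun j i => c i j) s) (Sum.elim (fun _ => 0) fun l => h (q l))
    ⟨fun j => b (p j), by
      rintro (j | l)
      · simpa using (hrel N _).2 ⟨b, fun _ => rfl⟩ j
      · have := LinearMap.congr_fun hab (q l)
        simp only [LinearMap.comp_apply] at this
        simp only [Sum.elim_inr, ← map_smul, ← map_sum]
        rw [hs, this]⟩
  obtain ⟨b', hb'⟩ := (hrel L y).1 fun j => hy (Sum.inl j)
  refine ⟨P, a, b', hP, LinearMap.ext_on_range hq fun l => ?_⟩
  rw [LinearMap.comp_apply, ← hs, map_sum]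
  simp only [map_smul, hb']
  exact hy (Sum.inr l)

/-- With left `B`-approximations `F → P`, the components of a homomorphism from `F` to a product
factor through the same module `P`. -/
theorem FactorsThrough.pi {I : Type u} {N : I → ModuleCat.{u} R}
    (happ : ∀ (F : ModuleCat.{u} R) [Module.FinitePresentation R F],
      ∃ (P : ModuleCat.{u} R) (a : F →ₗ[R] P), B P ∧
        ∀ (N : ModuleCat.{u} R), B N → ∀ h : F →ₗ[R] N, ∃ g : P →ₗ[R] N, g ∘ₗ a = h)
    (hN : ∀ i, FactorsThrough B (N i)) : FactorsThrough B (ModuleCat.of R (∀ i, N i)) := by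
  intro F _ h
  obtain ⟨P, a, hP, ha⟩ := happ F
  have (i : I) : ∃ g : P →ₗ[R] N i, g ∘ₗ a = LinearMap.proj i ∘ₗ h := by
    obtain ⟨Q, c, d, hQ, hcd⟩ := hN i F (LinearMap.proj i ∘ₗ h)
    obtain ⟨g, rfl⟩ := ha Q hQ c
    exact ⟨d ∘ₗ g, hcd⟩
  choose g hg using this
  exact ⟨P, a, LinearMap.pi g, hP,
    LinearMap.ext fun x => funext fun i => LinearMap.congr_fun (hg i) x⟩

end Lim

section Stages

/-! ### Modules presented as direct limits -/

variable {R : Type u} [Ring R] {N : ModuleCat.{u} R} {B : ObjectProperty (ModuleCat.{u} R)}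

/-- A directed system of modules in `B` over `N` has the limit `N` if its maps to `N` are jointly
surjective and every element of their kernels dies at a later stage. -/
theorem limClosure_of_directedSystem {I : Type u} [Preorder I] [IsDirectedOrder I] [Nonempty I]
    (G : I → ModuleCat.{u} R) (f : ∀ i j, i ≤ j → G i →ₗ[R] G j)
    [DirectedSystem (fun i => G i) (fun i j h => f i j h)] (hG : ∀ i, B (G i))
    (g : ∀ i, G i →ₗ[R] N) (hg : ∀ i j h x, g j (f i j h x) = g i x)
    (hker : ∀ i x, g i x = 0 → ∃ j h, f i j h x = 0) (hsurj : ∀ y, ∃ i x, g i x = y) :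
    LimClosure B N := by
  classical
  let π : Module.DirectLimit (fun i => G i) f →ₗ[R] N := Module.DirectLimit.lift R I _ f g hg
  refine LimClosure.iso _ N (LinearEquiv.ofBijective π ⟨?_, fun y => ?_⟩)
    (LimClosure.directLimit G f fun i => LimClosure.base _ (hG i))
  · rw [injective_iff_map_eq_zero]
    intro z hz
    obtain ⟨i, x, rfl⟩ := Module.DirectLimit.exists_of z
    rw [Module.DirectLimit.lift_of] at hz
    obtain ⟨j, hij, hj⟩ := hker i x hz
    rw [← Module.DirectLimit.of_f (hij := hij), hj, map_zero]
  · obtain ⟨i, x, rfl⟩ := hsurj y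
    exact ⟨Module.DirectLimit.of R I _ f i x, Module.DirectLimit.lift_of _ _ _⟩

variable {F : Type u} [AddCommGroup F] [Module R F]

/-- The factorization property for the finitely presented module `E ⧸ V`, in terms of `E`. -/
theorem FactorsThrough.exists_factorization (hN : FactorsThrough B N) (c : F →ₗ[R] N)
    (E V : Submodule R F) [Module.FinitePresentation R E] (hV : V.FG) (hVE : V ≤ E)
    (hVc : V ≤ LinearMap.ker c) :
    ∃ (P : ModuleCat.{u} R) (a : E →ₗ[R] P) (b : P →ₗ[R] N), B P ∧ (∀ x, b (a x) = c x) ∧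
      ∀ x : E, (x : F) ∈ V → a x = 0 := by
  let V₀ : Submodule R E := V.comap E.subtype
  have hV₀ : V₀.FG := by
    refine Submodule.fg_of_fg_map_injective E.subtype E.injective_subtype ?_
    rwa [Submodule.map_comap_subtype, inf_eq_right.2 hVE]
  have : Module.FinitePresentation R (E ⧸ V₀) :=
    Module.finitePresentation_of_surjective V₀.mkQ V₀.mkQ_surjective (by rwa [Submodule.ker_mkQ])
  obtain ⟨P, a, b, hP, hab⟩ := hN (ModuleCat.of R (E ⧸ V₀))
    (V₀.liftQ (c ∘ₗ E.subtype) fun x hx => hVc hx)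
  refine ⟨P, a ∘ₗ V₀.mkQ, b, hP, fun x => LinearMap.congr_fun hab (V₀.mkQ x), fun x hx => ?_⟩
  have h0 : V₀.mkQ x = 0 := (Submodule.Quotient.mk_eq_zero V₀).2 hx
  rw [LinearMap.comp_apply, h0, map_zero]

/-- The map onto `N` from a free module with infinitely many free generators `(x, 0)`, `(x, 1)`, …
over each element `x` of `N`. -/
noncomputable def freeCover (β : Module.Basis (N × ℕ) R F) : F →ₗ[R] N := β.constr ℕ Prod.fst

theorem freeCover_basis (β : Module.Basis (N × ℕ) R F) (u : N × ℕ) : freeCover β (β u) = u.1 :=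
  β.constr_basis ℕ _ u

/-- The submodule generated by the free generators in `U`. -/
def freeSpan (β : Module.Basis (N × ℕ) R F) (U : Finset (N × ℕ)) : Submodule R F :=
  Submodule.span R (Set.range fun u : U => β u)

variable {β : Module.Basis (N × ℕ) R F}

theorem basis_mem_freeSpan {U : Finset (N × ℕ)} {u : N × ℕ} (hu : u ∈ U) : β u ∈ freeSpan β U :=
  Submodule.subset_span ⟨⟨u, hu⟩, rfl⟩

theorem freeSpan_mono {U W : Finset (N × ℕ)} (h : U ⊆ W) : freeSpan β U ≤ freeSpan β W := by
  rw [freeSpan, Submodule.span_le]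
  rintro _ ⟨u, rfl⟩
  exact basis_mem_freeSpan (h u.2)

theorem finitePresentation_freeSpan (U : Finset (N × ℕ)) :
    Module.FinitePresentation R (freeSpan β U) := by
  have b : Module.Basis U R (freeSpan β U) :=
    Module.Basis.span (β.linearIndependent.comp (fun u : U => (u : N × ℕ)) Subtype.val_injective)
  have := Module.Free.of_basis b
  have := Module.Finite.of_basis b
  exact Module.finitePresentation_of_projective R _

/-- The module generated by the free generators in `U`, with relations `V`, if `j = (U, V)`. -/
def stage (β : Module.Basis (N × ℕ) R F) (j : Finset (N × ℕ) × Submodule R F) :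
    Submodule R (F ⧸ j.2) :=
  (freeSpan β j.1).map j.2.mkQ

/-- The pair `j = (U, V)` is a finite presentation over `N`: the relations `V` are finitely
generated, involve only the generators in `U`, and hold in `N`. -/
structure IsFinitePresentationOver (β : Module.Basis (N × ℕ) R F)
    (j : Finset (N × ℕ) × Submodule R F) : Prop where
  fg : j.2.FG
  le_span : j.2 ≤ freeSpan β j.1
  le_ker : j.2 ≤ LinearMap.ker (freeCover β)

/-- Finite presentations over `N` of modules in `B` are cofinal if homomorphisms from finitely
presented modules to `N` factor through modules in `B`. Given `(U, V)`, factor the map from the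
module presented by it through `P` in `B`, and adjoin new free generators that map to generators
of `P`. -/
theorem FactorsThrough.exists_stage_ge (hB : IsAdditiveFP B) (hN : FactorsThrough B N)
    {j : Finset (N × ℕ) × Submodule R F} (hj : IsFinitePresentationOver β j) :
    ∃ k, j ≤ k ∧ IsFinitePresentationOver β k ∧ B (ModuleCat.of R (stage β k)) := by
  classical
  obtain ⟨U, V⟩ := j
  obtain ⟨hfg, hspan, hker⟩ := hj
  dsimp only at hfg hspan hker
  have := finitePresentation_freeSpan (β := β) U
  obtain ⟨P, a, b, hP, hab, haV⟩ := hN.exists_factorization (freeCover β) (freeSpan β U) V hfg hspan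
    hker
  have := hB.finitePresentation P hP
  obtain ⟨n, p, hp⟩ := Submodule.fg_iff_exists_fin_generating_family.1
    (Module.Finite.fg_top (R := R) (M := P))
  obtain ⟨t, ht⟩ : ∃ t : ℕ, ∀ u ∈ U, u.2 < t :=
    ⟨U.sup Prod.snd + 1, fun u hu => Nat.lt_succ_of_le (Finset.le_sup hu)⟩
  -- As `t` exceeds all second coordinates in `U`, the generators `(b (p l), t + l)` are new.
  let σ : N × ℕ → P := fun u => if hu : u ∈ U then a ⟨β u, basis_mem_freeSpan hu⟩ else
    if h : u.2 - t < n then p ⟨u.2 - t, h⟩ else 0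
  let τ : F →ₗ[R] P := β.constr ℕ σ
  have hτ (u : N × ℕ) : τ (β u) = σ u := β.constr_basis ℕ σ u
  let W : Finset (N × ℕ) := Finset.univ.image fun l : Fin n => (b (p l), t + l)
  have := finitePresentation_freeSpan (β := β) (U ∪ W)
  have hσU (u : N × ℕ) (hu : u ∈ U) : σ u = a ⟨β u, basis_mem_freeSpan hu⟩ := dif_pos hu
  have hσW (l : Fin n) : σ (b (p l), t + l) = p l := by
    have h1 : (b (p l), t + (l : ℕ)) ∉ U := fun h => absurd (ht _ h) (by simp)
    simp only [σ, dif_neg h1, Nat.add_sub_cancel_left, l.2, dif_pos, Fin.eta]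
  have hbσ (u : N × ℕ) (hu : u ∈ U ∪ W) : b (σ u) = u.1 := by
    rcases Finset.mem_union.1 hu with hu | hu
    · rw [hσU u hu, hab, freeCover_basis]
    · obtain ⟨l, -, rfl⟩ := Finset.mem_image.1 hu
      rw [hσW]
  have hbτ : Set.EqOn (b ∘ₗ τ) (freeCover β) (freeSpan β (U ∪ W)) := by
    refine LinearMap.eqOn_span ?_
    rintro _ ⟨u, rfl⟩
    rw [LinearMap.comp_apply, hτ, hbσ u u.2, freeCover_basis]
  have hτU (x : freeSpan β U) : τ x = a x := by
    obtain ⟨x, hx⟩ := x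
    induction hx using Submodule.span_induction with
    | mem x hx =>
      obtain ⟨u, rfl⟩ := hx
      exact (hτ u).trans (hσU u u.2)
    | zero => exact (map_zero τ).trans (map_zero a).symm
    | add x y hx hy h1 h2 =>
      exact (map_add τ x y).trans ((congrArg₂ (· + ·) h1 h2).trans (map_add a ⟨x, hx⟩ ⟨y, hy⟩).symm)
    | smul r x hx h =>
      exact (map_smul τ r x).trans ((congrArg (r • ·) h).trans (map_smul a r ⟨x, hx⟩).symm)
  have hsurj : Function.Surjective (τ ∘ₗ (freeSpan β (U ∪ W)).subtype) := by
    rw [← LinearMap.range_eq_top, eq_top_iff, ← hp, Submodule.span_le]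
    rintro _ ⟨l, rfl⟩
    exact ⟨⟨β (b (p l), t + (l : ℕ)), basis_mem_freeSpan
      (Finset.mem_union_right _ (Finset.mem_image.2 ⟨l, Finset.mem_univ _, rfl⟩))⟩,
      (hτ _).trans (hσW l)⟩
  let V' : Submodule R F := (LinearMap.ker (τ ∘ₗ (freeSpan β (U ∪ W)).subtype)).map
    (freeSpan β (U ∪ W)).subtype
  have hV' (x : F) : x ∈ V' ↔ x ∈ freeSpan β (U ∪ W) ∧ τ x = 0 := by
    constructor
    · rintro ⟨y, hy, rfl⟩
      exact ⟨y.2, hy⟩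
    · rintro ⟨hx, h0⟩
      exact ⟨⟨x, hx⟩, h0, rfl⟩
  refine ⟨(U ∪ W, V'), ⟨Finset.subset_union_left, fun x hx => ?_⟩, ⟨?_, fun x hx => ?_,
    fun x hx => ?_⟩, ?_⟩
  · exact (hV' x).2 ⟨freeSpan_mono Finset.subset_union_left (hspan hx),
      (hτU ⟨x, hspan hx⟩).trans (haV _ hx)⟩
  · exact (Module.FinitePresentation.fg_ker _ hsurj).map _
  · exact ((hV' x).1 hx).1
  · rw [LinearMap.mem_ker, ← hbτ ((hV' x).1 hx).1, LinearMap.comp_apply, ((hV' x).1 hx).2, map_zero]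
  · let θ : stage β (U ∪ W, V') →ₗ[R] P :=
      V'.liftQ τ (fun x hx => ((hV' x).1 hx).2) ∘ₗ (stage β (U ∪ W, V')).subtype
    refine hB.iso P _ (LinearEquiv.ofBijective θ ⟨?_, fun q => ?_⟩).symm hP
    · rw [injective_iff_map_eq_zero]
      rintro ⟨_, x, hx, rfl⟩ h0
      exact Subtype.ext ((Submodule.Quotient.mk_eq_zero V').2 ((hV' x).2 ⟨hx, h0⟩))
    · obtain ⟨x, hx⟩ := hsurj q
      exact ⟨⟨_, x, x.2, rfl⟩, hx⟩

/-- A module `N` such that homomorphisms from finitely presented modules to `N` factor through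
modules in `B` is a direct limit of modules in `B`, namely of the modules in `B` that are given by
finite presentations over `N`. -/
theorem FactorsThrough.limClosure (hB : IsAdditiveFP B) (hN : FactorsThrough B N) :
    LimClosure B N := by
  classical
  obtain ⟨F, _, _, ⟨β⟩⟩ : ∃ (F : Type u) (_ : AddCommGroup F) (_ : Module R F),
      Nonempty (Module.Basis (N × ℕ) R F) :=
    ⟨(N × ℕ) →₀ R, inferInstance, inferInstance, ⟨Finsupp.basisSingleOne⟩⟩
  let J := {j : Finset (N × ℕ) × Submodule R F //
    IsFinitePresentationOver β j ∧ B (ModuleCat.of R (stage β j))}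
  have hcof (j : Finset (N × ℕ) × Submodule R F) (hj : IsFinitePresentationOver β j) :
      ∃ k : J, j ≤ k.1 := by
    obtain ⟨k, hjk, hk⟩ := hN.exists_stage_ge hB hj
    exact ⟨⟨k, hk⟩, hjk⟩
  have : Nonempty J := ⟨(hcof (∅, ⊥) ⟨Submodule.fg_bot, bot_le, bot_le⟩).choose⟩
  have : IsDirectedOrder J := ⟨fun j k => by
    obtain ⟨l, hl⟩ := hcof (j.1 ⊔ k.1) ⟨j.2.1.fg.sup k.2.1.fg,
      sup_le (j.2.1.le_span.trans (freeSpan_mono Finset.subset_union_left))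
        (k.2.1.le_span.trans (freeSpan_mono Finset.subset_union_right)),
      sup_le j.2.1.le_ker k.2.1.le_ker⟩
    exact ⟨l, le_sup_left.trans hl, le_sup_right.trans hl⟩⟩
  let f : ∀ i j : J, i ≤ j → stage β i.1 →ₗ[R] stage β j.1 := fun i j h =>
    (Submodule.factor h.2).restrict (p := stage β i.1) (q := stage β j.1) (by
      rintro _ ⟨x, hx, rfl⟩
      exact ⟨x, freeSpan_mono h.1 hx, rfl⟩)
  have : DirectedSystem (fun i : J => ModuleCat.of R (stage β i.1)) (fun i j h => f i j h) :=
    { map_self := by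
        rintro i ⟨_, x, hx, rfl⟩
        rfl
      map_map := by
        rintro i j k hij hjk ⟨_, x, hx, rfl⟩
        rfl }
  refine limClosure_of_directedSystem (fun i : J => ModuleCat.of R (stage β i.1)) f
    (fun i => i.2.2)
    (fun i => i.1.2.liftQ (freeCover β) i.2.1.le_ker ∘ₗ (stage β i.1).subtype) ?_ ?_ fun x => ?_
  · rintro i j h ⟨_, x, hx, rfl⟩
    rfl
  · rintro i ⟨_, x, hx, rfl⟩ h0
    have hx0 : freeCover β x = 0 := h0
    obtain ⟨k, hk⟩ := hcof (i.1.1, i.1.2 ⊔ Submodule.span R {x})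
      ⟨i.2.1.fg.sup (Submodule.fg_span_singleton x), sup_le i.2.1.le_span
        ((Submodule.span_singleton_le_iff_mem _ _).2 hx), sup_le i.2.1.le_ker
        ((Submodule.span_singleton_le_iff_mem _ _).2 hx0)⟩
    refine ⟨k, ⟨hk.1, le_sup_left.trans hk.2⟩, Subtype.ext ?_⟩
    exact (Submodule.Quotient.mk_eq_zero k.1.2).2
      (hk.2 (Submodule.mem_sup_right (Submodule.mem_span_singleton_self x)))
  · obtain ⟨k, hk⟩ := hcof ({(x, 0)}, ⊥) ⟨Submodule.fg_bot, bot_le, bot_le⟩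
    exact ⟨k, ⟨_, β (x, 0), basis_mem_freeSpan (hk.1 (Finset.mem_singleton_self _)), rfl⟩,
      freeCover_basis β _⟩

end Stages

section Closure

/-! ### Closure under products and pure submodules -/

variable {S : Type u} [Ring S] {X : ObjectProperty (ModuleCat.{u} S)}

theorem ProdClosure.prodPlusClosure {N : ModuleCat.{u} S} (h : ProdClosure X N) :
    ProdPlusClosure X N := by
  induction h with
  | base N h => exact .base N h
  | product N _ ih => exact .product N ih
  | summand N L i p hpi _ ih => exact .pureSubmodule N L i (.of_leftInverse i p hpi) ih

/-- An inclusion between subgroups defined by formulas is inherited by products and pure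
submodules. -/
theorem ProdPlusClosure.sol_le {φ ψ : PPFormula S} (hX : ∀ N, X N → φ.sol N ≤ ψ.sol N)
    {N : ModuleCat.{u} S} (h : ProdPlusClosure X N) : φ.sol N ≤ ψ.sol N := by
  induction h with
  | base N h => exact hX N h
  | product N _ ih =>
    intro x hx
    exact ψ.mem_sol_pi.2 fun i => ih i (φ.mem_sol_pi.1 hx i)
  | pureSubmodule N L i hi _ ih =>
    intro x hx
    exact ψ.mem_sol_of_pure hi (ih (φ.map_mem_sol i hx))

/-- The descending chain condition for `K` carries over to the closure under products and pure
submodules of any class of modules that embed purely into `K`. -/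
theorem ProdPlusClosure.isPureInjective {K : ModuleCat.{u} S} (hK : PPDescending S K)
    (hX : ∀ N, X N → ∃ f : N →ₗ[S] K, IsPureEmbedding f) {N : ModuleCat.{u} S}
    (h : ProdPlusClosure X N) : IsPureInjective N := by
  refine PPDescending.isPureInjective fun Φ hne hconj => ?_
  obtain ⟨φ, hφ, hmin⟩ := hK Φ hne hconj
  refine ⟨φ, hφ, fun ψ hψ => h.sol_le fun L hL x hx => ?_⟩
  obtain ⟨f, hf⟩ := hX L hL
  exact ψ.mem_sol_of_pure hf (hmin ψ hψ (φ.map_mem_sol f hx))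

theorem prodClosure_eq_prodPlusClosure (hX : ∀ N, ProdPlusClosure X N → IsPureInjective N) :
    ProdClosure X = ProdPlusClosure X := by
  funext N
  refine propext ⟨fun h => h.prodPlusClosure, fun h => ?_⟩
  induction h with
  | base N h => exact .base N h
  | product N _ ih => exact .product N ih
  | pureSubmodule N L i hi h ih =>
    obtain ⟨p, hp⟩ := (hX L (.pureSubmodule N L i hi h)).exists_retraction i hi
    exact .summand N L i p hp ih

/-- If all modules in the closure under products and pure submodules are pure-injective, then this
closure is definable: the kernel of the map from a direct sum to a direct limit is pure, hence
splits off, so the limit is a direct summand of the direct sum. -/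
theorem isDefinable_prodPlusClosure (hX : ∀ N, ProdPlusClosure X N → IsPureInjective N) :
    IsDefinable (ProdPlusClosure X) where
  product N h := .product N h
  pureSubmodule N L i hi h := .pureSubmodule N L i hi h
  directLimit {I} _ _ _ _ G f _ h := by
    let D := ModuleCat.of S (DirectSum I fun i => G i)
    have hD : ProdPlusClosure X D := .pureSubmodule (ModuleCat.of S (∀ i, G i)) D
      (DirectSum.coeFnLinearMap S) (isPureEmbedding_directSum_pi fun i => G i) (.product G h)
    let q : D →ₗ[S] Module.DirectLimit (fun i => G i) f := directSumToLimit G f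
    have hK : ProdPlusClosure X (ModuleCat.of S (LinearMap.ker q)) :=
      .pureSubmodule D _ (LinearMap.ker q).subtype isPureEmbedding_ker_directSumToLimit hD
    obtain ⟨p, hp⟩ := (hX _ hK).exists_retraction (N := D) (LinearMap.ker q).subtype
      isPureEmbedding_ker_directSumToLimit
    have hker : LinearMap.ker q ≤
        LinearMap.ker (LinearMap.id - (LinearMap.ker q).subtype ∘ₗ p : D →ₗ[S] D) := fun x hx =>
      sub_eq_zero.2 (congrArg Subtype.val (LinearMap.congr_fun hp ⟨x, hx⟩)).symm
    let e := q.quotKerEquivOfSurjective directSumToLimit_surjective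
    let s : Module.DirectLimit (fun i => G i) f →ₗ[S] D :=
      (LinearMap.ker q).liftQ _ hker ∘ₗ e.symm.toLinearMap
    have hs : q ∘ₗ s = LinearMap.id := by
      refine LinearMap.ext fun z => ?_
      obtain ⟨x, rfl⟩ := directSumToLimit_surjective z
      have h1 : e.symm (q x) = Submodule.Quotient.mk x := by
        rw [LinearEquiv.symm_apply_eq]
        rfl
      have h2 : s (q x) = x - (p x : LinearMap.ker q) := congrArg _ h1
      change q (s (q x)) = q x
      rw [h2, map_sub]
      exact (congrArg (q x - ·) (p x).2).trans (sub_zero _)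
    exact .pureSubmodule D _ s (.of_leftInverse s q hs) hD

/-- The closure under pure submodules is reached in one step. -/
theorem PureClosure.exists_pureEmbedding {N : ModuleCat.{u} S} (h : PureClosure X N) :
    ∃ (L : ModuleCat.{u} S) (f : N →ₗ[S] L), X L ∧ IsPureEmbedding f := by
  induction h with
  | base N h => exact ⟨N, LinearMap.id, h, .of_equiv (LinearEquiv.refl S N)⟩
  | pureSubmodule N L i hi _ ih =>
    obtain ⟨K, f, hK, hf⟩ := ih
    exact ⟨K, f ∘ₗ i, hK, hf.comp hi⟩

end Closure

section Dual

/-! ### Closures of a class of duals -/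

variable {R : Type u} [Ring R] {B : ObjectProperty (ModuleCat.{u} R)}

theorem ProdClosure.isPureInjective_of_dualClass {N : ModuleCat.{u} Rᵐᵒᵖ}
    (h : ProdClosure (dualClass B) N) : IsPureInjective N := by
  induction h with
  | base N h =>
    obtain ⟨L, -, ⟨e⟩⟩ := h
    exact (isPureInjective_dual L).of_retract e.toLinearMap e.symm.toLinearMap (by ext; simp)
  | product N _ ih => exact .pi ih
  | summand N L i p hpi _ ih => exact ih.of_retract i p hpi

theorem exists_pureEmbedding_dual_directSum {ι : Type u} (X : ι → ModuleCat.{u} R)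
    (hX' : ∀ N : ModuleCat.{u} R, B N → ∃ i, Nonempty (N ≃ₗ[R] X i)) (N : ModuleCat.{u} Rᵐᵒᵖ)
    (hN : dualClass B N) :
    ∃ f : N →ₗ[Rᵐᵒᵖ] dual (ModuleCat.of R (DirectSum ι fun i => X i)), IsPureEmbedding f := by
  classical
  obtain ⟨L, hL, ⟨e⟩⟩ := hN
  obtain ⟨i, ⟨ε⟩⟩ := hX' L hL
  have h1 : IsPureEmbedding (dualMap (DirectSum.component R ι (fun i => X i) i)) := by
    refine .of_leftInverse _ (dualMap (DirectSum.lof R ι (fun i => X i) i)) ?_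
    refine LinearMap.ext fun c => CharacterModule.ext _ fun x => ?_
    exact congrArg c (DirectSum.component.lof_self (M := fun i => X i) R i x)
  exact ⟨_, h1.comp ((IsPureEmbedding.of_equiv (dualEquiv ε.symm)).comp (.of_equiv e))⟩

/-- If the direct sum of the representatives of `B` is noetherian over its endomorphism ring, then
`Prod⁺(B^*)` consists of pure-injective modules. -/
theorem isPureInjective_of_prodPlusClosure_dualClass {ι : Type u} (X : ι → ModuleCat.{u} R)
    (hX' : ∀ N : ModuleCat.{u} R, B N → ∃ i, Nonempty (N ≃ₗ[R] X i))
    [IsNoetherian (Module.End R (DirectSum ι fun i => X i)) (DirectSum ι fun i => X i)]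
    (N : ModuleCat.{u} Rᵐᵒᵖ) (hN : ProdPlusClosure (dualClass B) N) : IsPureInjective N :=
  hN.isPureInjective (ppDescending_character_of_isNoetherian _)
    (exists_pureEmbedding_dual_directSum X hX')

theorem prodClosure_dual_directSum {ι : Type u} {X : ι → ModuleCat.{u} R} (hX : ∀ i, B (X i)) :
    ProdClosure (dualClass B) (dual (ModuleCat.of R (DirectSum ι fun i => X i))) := by
  obtain ⟨e⟩ := nonempty_dual_directSum_equiv X
  exact .summand (ModuleCat.of Rᵐᵒᵖ (∀ i, dual (X i))) _ e.toLinearMap e.symm.toLinearMap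
    (by ext; simp)
    (.product (fun i => dual (X i)) fun i => .base _ ⟨X i, hX i, ⟨LinearEquiv.refl _ _⟩⟩)

/-- In a definable subcategory consisting of pure-injective modules, all modules are
`Σ`-pure-injective, because `N^(I)` is pure in `N^I`. -/
theorem isSigmaPureInjective_of_mem_definable {N : ModuleCat.{u} R}
    {C : ObjectProperty (ModuleCat.{u} R)} (hC : IsDefinable C)
    (hpi : ∀ L, C L → IsPureInjective L) (hN : C N) : IsSigmaPureInjective N := fun I _ =>
  hpi _ (hC.pureSubmodule (ModuleCat.of R (I → N)) _ Finsupp.lcoeFun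
    (isPureEmbedding_finsupp_pi I) (hC.product _ fun _ => hN))

/-- If finitely presented modules have left `B`-approximations, then the direct limits of modules
in `B` form a definable subcategory. -/
theorem isDefinable_limClosure (hB : IsAdditiveFP B)
    (happ : ∀ (F : ModuleCat.{u} R) [Module.FinitePresentation R F],
      ∃ (P : ModuleCat.{u} R) (a : F →ₗ[R] P), B P ∧
        ∀ (N : ModuleCat.{u} R), B N → ∀ h : F →ₗ[R] N, ∃ g : P →ₗ[R] N, g ∘ₗ a = h) :
    IsDefinable (LimClosure B) where
  product _ h := (FactorsThrough.pi happ fun i => (h i).factorsThrough).limClosure hB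
  directLimit G f _ h := .directLimit G f h
  pureSubmodule _ _ i hi h := (h.factorsThrough.of_pure hB i hi).limClosure hB

theorem dual_mem_of_limClosure {C : ObjectProperty (ModuleCat.{u} Rᵐᵒᵖ)} (hC : IsDefinable C)
    (hB : ∀ N, B N → C (dual N)) {N : ModuleCat.{u} R} (hN : LimClosure B N) : C (dual N) := by
  induction hN with
  | base N h => exact hB N h
  | directLimit G f _ ih =>
    exact hC.pureSubmodule (ModuleCat.of Rᵐᵒᵖ (∀ i, dual (G i))) _ _
      isPureEmbedding_dual_directLimit (hC.product _ ih)
  | iso N L e _ ih =>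
    exact hC.pureSubmodule (dual N) (dual L) (dualEquiv e).toLinearMap (.of_equiv _) ih

/-- The elementary dual of a definable subcategory `D` is closed under products: a product of
duals is the dual of a direct sum, and direct sums of modules in `D` lie in `D`, being pure in the
product. -/
theorem ProdClosure.elementaryDual {D : ObjectProperty (ModuleCat.{u} R)} (hD : IsDefinable D)
    (hBD : ∀ N, B N → D N) {N : ModuleCat.{u} Rᵐᵒᵖ} (hN : ProdClosure (dualClass B) N) :
    elementaryDual D N := by
  induction hN with
  | base N h =>
    obtain ⟨L, hL, e⟩ := h
    exact .base N ⟨L, hBD L hL, e⟩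
  | @product I N _ ih =>
    choose K f hK hf using fun i => (ih i).exists_pureEmbedding
    choose L hL e using hK
    obtain ⟨ε⟩ := nonempty_dual_directSum_equiv L
    have hsum : D (ModuleCat.of R (DirectSum I fun i => L i)) :=
      hD.pureSubmodule (ModuleCat.of R (∀ i, L i)) _ (DirectSum.coeFnLinearMap R)
        (isPureEmbedding_directSum_pi fun i => L i) (hD.product L hL)
    refine .pureSubmodule (dual (ModuleCat.of R (DirectSum I fun i => L i))) _
      (ε.symm.toLinearMap ∘ₗ LinearMap.pi fun i => ((e i).some.toLinearMap ∘ₗ f i) ∘ₗ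
        LinearMap.proj i) ?_ (.base _ ⟨_, hsum, ⟨LinearEquiv.refl _ _⟩⟩)
    exact (IsPureEmbedding.of_equiv ε.symm).comp
      (.pi _ fun i => (IsPureEmbedding.of_equiv (e i).some).comp (hf i))
  | summand N L i p hpi _ ih => exact .pureSubmodule N L i (.of_leftInverse i p hpi) ih

theorem prodClosure_eq_elementaryDual
    (hdef : IsDefinable (ProdClosure (dualClass B))) (hlim : IsDefinable (LimClosure B)) :
    ProdClosure (dualClass B) = elementaryDual (LimClosure B) := by
  funext N
  refine propext ⟨fun h => h.elementaryDual hlim fun L hL => .base L hL, fun h => ?_⟩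
  obtain ⟨K, f, ⟨L, hL, ⟨e⟩⟩, hf⟩ := PureClosure.exists_pureEmbedding h
  refine hdef.pureSubmodule (dual L) N _ ((IsPureEmbedding.of_equiv e).comp hf)
    (dual_mem_of_limClosure hdef (fun P hP => ?_) hL)
  exact .base _ ⟨P, hP, ⟨LinearEquiv.refl _ _⟩⟩

end Dual

end ModClass

/-- `X` is a family of representatives of the isomorphism classes of modules in `B` (for instance
a skeleton), `M` is its direct sum. -/
theorem theorem5p3 {R : Type u} [Ring R] (B : ObjectProperty (ModuleCat.{u} R))
    (hB : ModClass.IsAdditiveFP B)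
    {ι : Type u} (X : ι → ModuleCat.{u} R) (hX : ∀ i, B (X i))
    (hX' : ∀ N : ModuleCat.{u} R, B N → ∃ i, Nonempty (N ≃ₗ[R] X i))
    (M : ModuleCat.{u} R) (hM : M = ModuleCat.of R (DirectSum ι fun i => X i)) :
    Nonempty (ModClass.dual M ≃ₗ[Rᵐᵒᵖ] ∀ i, ModClass.dual (X i)) ∧
    List.TFAE
      [ModClass.IsDefinable (ModClass.ProdClosure (ModClass.dualClass B)),
        ModClass.IsSigmaPureInjective (ModClass.dual M),
        IsNoetherian (Module.End R M) M] ∧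
    (ModClass.IsDefinable (ModClass.ProdClosure (ModClass.dualClass B)) →
      ModClass.ProdClosure (ModClass.dualClass B) =
        ModClass.ProdPlusClosure (ModClass.dualClass B) ∧
      ModClass.IsDefinable (ModClass.ProdPlusClosure (ModClass.dualClass B)) ∧
      ModClass.IsDefinable (ModClass.LimClosure B) ∧
      ModClass.ProdClosure (ModClass.dualClass B) =
        ModClass.elementaryDual (ModClass.LimClosure B)) := by
  subst hM
  have h12 (h : ModClass.IsDefinable (ModClass.ProdClosure (ModClass.dualClass B))) :
      ModClass.IsSigmaPureInjective
        (ModClass.dual (ModuleCat.of R (DirectSum ι fun i => X i))) :=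
    ModClass.isSigmaPureInjective_of_mem_definable h
      (fun _ hL => hL.isPureInjective_of_dualClass) (ModClass.prodClosure_dual_directSum hX)
  have h23 := hB.isNoetherian_of_isSigmaPureInjective hX
  have hplus (h : IsNoetherian (Module.End R (DirectSum ι fun i => X i))
      (DirectSum ι fun i => X i)) :=
    ModClass.isPureInjective_of_prodPlusClosure_dualClass (B := B) X hX'
  refine ⟨ModClass.nonempty_dual_directSum_equiv X, ?_, fun h => ?_⟩
  · tfae_have 1 → 2 := h12
    tfae_have 2 → 3 := h23
    tfae_have 3 → 1 := fun h => by
      rw [ModClass.prodClosure_eq_prodPlusClosure (hplus h)]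
      exact ModClass.isDefinable_prodPlusClosure (hplus h)
    tfae_finish
  · have hN := h23 (h12 h)
    have hlim : ModClass.IsDefinable (ModClass.LimClosure B) :=
      ModClass.isDefinable_limClosure hB fun F _ => hB.exists_leftApproximation hX hX' F
    exact ⟨ModClass.prodClosure_eq_prodPlusClosure (hplus hN),
      ModClass.isDefinable_prodPlusClosure (hplus hN), hlim,
      ModClass.prodClosure_eq_elementaryDual h hlim⟩
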